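/- All graphs are finite, connected multigraphs (multiple edges and loops are allowed). A \emph{mixing involution} of a graph $G$ is an automorphism $\alpha$ of $G$ of order two (acting on vertices and on edges) such that whenever an edge $e$ between $x$ and $y$ satisfies $\alpha(e)=e$, one has $\alpha(x)=y$. The quotient $G/\alpha$ has as vertices the orbits $\{v,\alpha(v)\}$ of vertices of $G$, and as edges the orbits $\{e,\alpha(e)\}$ of those edges $e$ of $G$ whose two ends lie in different orbits. The (Euler) genus of a connected graph with vertex set $V$ and edge set $E$ is $|E|-|V|+1$. A graph $G$ is \emph{bielliptic} if it admits a mixing involution $\alpha$ such that $G/\alpha$ has Euler genus one. The \emph{orientable genus} of $G$ is the least $g$ such that $G$ embeds in the closed orientable surface of genus $g$, and $G$ is \emph{toroidal} if its orientable genus is at most $1$. \textbf{Theorem.} Every bielliptic graph embeds in the torus; hence its orientable genus is at most $1$, that is, all bielliptic graphs are toroidal. -/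

import Mathlib

open scoped Graph

namespace Graph

universe u v

/-- `G` is connected: it has a vertex and any two vertices are joined by a walk. -/
def IsConnected {α : Type u} {β : Type v} (G : Graph α β) : Prop :=
  V(G).Nonempty ∧ ∀ x ∈ V(G), ∀ y ∈ V(G), Relation.ReflTransGen G.Adj x y

/-- The (Euler) genus `|E| - |V| + 1` of a finite connected graph. -/
noncomputable def eulerGenus {α : Type u} {β : Type v} (G : Graph α β) : ℤ :=
  (E(G).ncard : ℤ) - (V(G).ncard : ℤ) + 1

/-- A mixing involution of a multigraph: an automorphism of order two (acting on vertices and on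
edges) such that an edge between `x` and `y` that is fixed has `x` sent to `y`. The values of
`onV` and `onE` outside the vertex set and the edge set are irrelevant. -/
structure MixingInvolution {α : Type u} {β : Type v} (G : Graph α β) where
  /-- the action on vertices -/
  onV : α → α
  /-- the action on edges -/
  onE : β → β
  mapsTo_vertexSet : ∀ x ∈ V(G), onV x ∈ V(G)
  map_isLink : ∀ e x y, G.IsLink e x y → G.IsLink (onE e) (onV x) (onV y)
  onV_onV : ∀ x ∈ V(G), onV (onV x) = x
  onE_onE : ∀ e ∈ E(G), onE (onE e) = e
  ne_id : (∃ x ∈ V(G), onV x ≠ x) ∨ (∃ e ∈ E(G), onE e ≠ e)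
  mixing : ∀ e x y, G.IsLink e x y → onE e = e → onV x = y

namespace MixingInvolution

variable {α : Type u} {β : Type v} {G : Graph α β}

/-- The orbit `{x, ι x}` of a vertex. -/
def orbitV (ι : G.MixingInvolution) (x : α) : Set α := {x, ι.onV x}

/-- The orbit `{e, ι e}` of an edge. -/
def orbitE (ι : G.MixingInvolution) (e : β) : Set β := {e, ι.onE e}

theorem orbitV_onV (ι : G.MixingInvolution) {x : α} (hx : x ∈ V(G)) :
    ι.orbitV (ι.onV x) = ι.orbitV x := by
  simp only [orbitV, ι.onV_onV x hx, Set.pair_comm]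

/-- The quotient of `G` by a mixing involution: its vertices are the orbits of vertices, and its
edges are the orbits of those edges whose two ends lie in different orbits. -/
def quotient (ι : G.MixingInvolution) : Graph (Set α) (Set β) where
  vertexSet := ι.orbitV '' V(G)
  IsLink a p q := ∃ e x y, G.IsLink e x y ∧ a = ι.orbitE e ∧
    p = ι.orbitV x ∧ q = ι.orbitV y ∧ p ≠ q
  isLink_symm := by
    rintro a -
    refine ⟨?_⟩
    rintro p q ⟨e, x, y, h, ha, hp, hq, hne⟩
    exact ⟨e, y, x, h.symm, ha, hq, hp, hne.symm⟩
  eq_or_eq_of_isLink_of_isLink := by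
    rintro a p q r s ⟨e, x, y, h, rfl, rfl, rfl, -⟩ ⟨f, z, w, h', hf, rfl, rfl, -⟩
    have hmem : e = f ∨ e = ι.onE f := by
      have : e ∈ ι.orbitE f := by
        rw [← hf]
        simp [orbitE]
      simpa [orbitE] using this
    rcases hmem with rfl | rfl
    · rcases h.left_eq_or_eq h' with rfl | rfl <;> simp
    · have h'' := ι.map_isLink _ _ _ h'
      rcases h.left_eq_or_eq h'' with rfl | rfl
      · exact Or.inl (ι.orbitV_onV h'.left_mem)
      · exact Or.inr (ι.orbitV_onV h'.right_mem)
  left_mem_of_isLink := by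
    rintro a p q ⟨e, x, y, h, -, rfl, -, -⟩
    exact ⟨x, h.left_mem, rfl⟩

end MixingInvolution

/-- `G` is bielliptic: it has a mixing involution whose quotient has genus one. -/
def IsBielliptic {α : Type u} {β : Type v} (G : Graph α β) : Prop :=
  ∃ ι : G.MixingInvolution, ι.quotient.eulerGenus = 1

/-- An embedding of a finite graph in a (Hausdorff) space `X`: distinct vertices go to distinct
points, each edge goes to an arc (a closed curve for a loop) joining the images of its ends, with
no self-intersection, no vertex in its interior, and no interior point on another edge. -/
structure Embedding {α : Type u} {β : Type v} (G : Graph α β)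
    (X : Type) [TopologicalSpace X] where
  /-- the point that represents a vertex -/
  point : α → X
  /-- the curve that represents an edge -/
  curve : β → C(unitInterval, X)
  point_injOn : Set.InjOn point V(G)
  curve_ends : ∀ e ∈ E(G), ∃ x y, G.IsLink e x y ∧ curve e 0 = point x ∧ curve e 1 = point y
  curve_injOn : ∀ e ∈ E(G), Set.InjOn (curve e) (Set.Ioo 0 1)
  curve_ne_point : ∀ e ∈ E(G), ∀ t ∈ Set.Ioo (0 : unitInterval) 1, ∀ x ∈ V(G),
    curve e t ≠ point x
  curve_ne_curve : ∀ e ∈ E(G), ∀ f ∈ E(G), e ≠ f →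
    ∀ s ∈ Set.Ioo (0 : unitInterval) 1, ∀ t ∈ Set.Ioo (0 : unitInterval) 1,
      curve e s ≠ curve f t

/-- The two-dimensional torus `ℝ/ℤ × ℝ/ℤ`. -/
abbrev Torus : Type := UnitAddCircle × UnitAddCircle

/-- The two-dimensional sphere. -/
abbrev Sphere : Type := Metric.sphere (0 : EuclideanSpace ℝ (Fin 3)) 1

/-- The closed unit disc, regarded as a polygon with curved sides. -/
abbrev Disc : Type := Metric.closedBall (0 : ℂ) 1

/-- The point at parameter `t ∈ [0,1]` on the `k`-th side of the disc, when its boundary is divided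
counterclockwise into `4 * g` equal sides numbered from `0`. -/
noncomputable def discSide (g k : ℕ) (t : ℝ) : Disc :=
  ⟨Complex.exp (((2 * Real.pi * ((k + t) / (4 * g)) : ℝ) : ℂ) * Complex.I), by
    rw [mem_closedBall_zero_iff, Complex.norm_exp_ofReal_mul_I]⟩

/-- The side identifications of the standard `4g`-gon with boundary word
`a₁ b₁ a₁⁻¹ b₁⁻¹ ⋯ a_g b_g a_g⁻¹ b_g⁻¹`. -/
inductive SideRel (g : ℕ) : Disc → Disc → Prop
  | a (j : ℕ) (hj : j < g) (t : ℝ) (ht : t ∈ Set.Icc (0 : ℝ) 1) :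
      SideRel g (discSide g (4 * j) t) (discSide g (4 * j + 2) (1 - t))
  | b (j : ℕ) (hj : j < g) (t : ℝ) (ht : t ∈ Set.Icc (0 : ℝ) 1) :
      SideRel g (discSide g (4 * j + 1) t) (discSide g (4 * j + 3) (1 - t))

/-- The closed orientable surface of genus `g ≥ 1` as the quotient of the standard `4g`-gon
(`Quot` is the topological quotient by the equivalence relation generated by `SideRel g`). -/
abbrev PolygonSurface (g : ℕ) : Type := Quot (SideRel g)

/-- `G` embeds in the closed orientable surface of genus `g`: the sphere for `g = 0`, the torus for
`g = 1`, the standard `4g`-gon with its sides identified for `g ≥ 2`. -/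
def EmbedsInGenus {α : Type u} {β : Type v} (G : Graph α β) : ℕ → Prop
  | 0 => Nonempty (G.Embedding Sphere)
  | 1 => Nonempty (G.Embedding Torus)
  | g + 2 => Nonempty (G.Embedding (PolygonSurface (g + 2)))

/-- The orientable genus of `G`: the least `g` such that `G` embeds in the closed orientable
surface of genus `g` (`⊤` if there were none). -/
noncomputable def orientableGenus {α : Type u} {β : Type v} (G : Graph α β) : ℕ∞ :=
  ⨅ (g : ℕ) (_ : G.EmbedsInGenus g), (g : ℕ∞)

end Graph

/-! A connected graph of genus one has as many edges as vertices, so the quotient `Q` is a cycle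
with trees attached. No structure theorem is needed: a spanning tree misses an edge, which closes a
cycle (`IsConnected.exists_cycle`). Growing that cycle by pendant edges until all vertices are
reached uses as many edges as there are vertices, hence all of them. Both growth processes are
instances of `IsConnected.exists_spanning`.

The drawing follows this growth. Over the cycle, orbit number `i` lies on the `i`-th meridian of the
torus at heights `±H i`, and consecutive orbits are joined by two disjoint edges. Lifting the cycle
may end at the other vertex of the initial orbit. The last pair of edges then turns by half a
revolution around the meridian, which interchanges `1/4` and `-1/4` modulo 1 without a crossing.
This is where the torus is used (`exists_drawing_of_lift`).

The rest is planar. A drawing carries, for each orbit, a free disc pinched at the vertices of that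
orbit (`IsDrawing`). In the disc of `{x, ι x}` there is room for a pendant orbit `{z, ι z}`, placed
as `x - z - ι z - ι x` along a line, with a new free disc between `z` and `ι z` and a thinner copy
of the old one (`IsDrawing.insert_leaf`). So the invariant survives all tree edges. The edges of `G`
invisible in `Q` have both ends in one orbit, and each fits in the disc of its orbit
(`IsDrawing.insert_verticals`). -/

namespace Graph

/-! ### Growing spanning subgraphs; a cycle in a graph of genus one -/

section Cycle

variable {γ δ : Type*} {Q : Graph γ δ}

/-- A proper nonempty set of vertices of a connected graph is left by some edge. -/
theorem IsConnected.exists_isLink_notMem (hQ : Q.IsConnected) {S : Set γ} (hS : S.Nonempty)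
    (hSV : S ⊆ V(Q)) (hne : ¬ V(Q) ⊆ S) : ∃ a p q, Q.IsLink a p q ∧ p ∈ S ∧ q ∉ S := by
  obtain ⟨x, hx⟩ := hS
  obtain ⟨y, hy, hyS⟩ := Set.not_subset.1 hne
  by_contra! h
  have key : ∀ z, Relation.ReflTransGen Q.Adj x z → z ∈ S := by
    intro z hz
    induction hz with
    | refl => exact hx
    | tail _ h₂ ih =>
      obtain ⟨a, ha⟩ := h₂
      exact h a _ _ ha ih
  exact hyS (key y (hQ.2 x (hSV hx) y hy))

/-- A property of a vertex set together with an edge set that is preserved when a pendant edge is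
added can be extended to a spanning subgraph, with the same number of surplus edges. -/
theorem IsConnected.exists_spanning (hQ : Q.IsConnected) (hV : V(Q).Finite)
    (P : Set γ → Set δ → Prop)
    (step : ∀ S F a p q, P S F → p ∈ S → q ∉ S → Q.IsLink a p q → a ∉ F →
      P (insert q S) (insert a F)) :
    ∀ (n : ℕ) (S : Set γ) (F : Set δ), (V(Q) \ S).ncard = n → P S F → S.Nonempty → S ⊆ V(Q) →
      F ⊆ E(Q) → F.Finite → (∀ a ∈ F, ∀ p q, Q.IsLink a p q → p ∈ S) →
      ∃ F', F' ⊆ E(Q) ∧ P V(Q) F' ∧ F'.ncard + S.ncard = F.ncard + V(Q).ncard := by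
  intro n
  induction n with
  | zero =>
    intro S F hn hP _ hSV hFE _ _
    rw [Set.ncard_eq_zero hV.sdiff] at hn
    obtain rfl : S = V(Q) := hSV.antisymm (Set.sdiff_eq_empty.1 hn)
    exact ⟨F, hFE, hP, rfl⟩
  | succ n ih =>
    intro S F hn hP hS hSV hFE hF hends
    have hne : ¬ V(Q) ⊆ S := by
      intro h
      rw [Set.sdiff_eq_empty.2 h] at hn
      simp at hn
    obtain ⟨a, p, q, hl, hp, hq⟩ := hQ.exists_isLink_notMem hS hSV hne
    have haF : a ∉ F := fun ha => hq (hends a ha q p hl.symm)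
    have hcard : (V(Q) \ insert q S).ncard = n := by
      have h1 : V(Q) \ insert q S = (V(Q) \ S) \ {q} := by
        ext z; simp only [Set.mem_sdiff, Set.mem_insert_iff, Set.mem_singleton_iff]; tauto
      rw [h1, Set.ncard_sdiff_singleton_of_mem (show q ∈ V(Q) \ S from ⟨hl.right_mem, hq⟩), hn]
      rfl
    obtain ⟨F', hF', hPF', hc⟩ := ih (insert q S) (insert a F) hcard
      (step S F a p q hP hp hq hl haF) (Set.insert_nonempty _ _)
      (Set.insert_subset hl.right_mem hSV) (Set.insert_subset hl.edge_mem hFE) (hF.insert a) (by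
        intro b hb r s hrs
        rcases Set.mem_insert_iff.1 hb with rfl | hb
        · rcases hrs.left_eq_or_eq hl with rfl | rfl
          · exact Or.inr hp
          · exact Or.inl rfl
        · exact Or.inr (hends b hb r s hrs))
    refine ⟨F', hF', hPF', ?_⟩
    rw [Set.ncard_insert_of_notMem hq (hV.subset hSV), Set.ncard_insert_of_notMem haF hF] at hc
    omega

/-- The simple graph of the adjacencies realised by an edge in `F`. -/
def adjVia (Q : Graph γ δ) (F : Set δ) : SimpleGraph γ where
  Adj p q := p ≠ q ∧ ∃ a ∈ F, Q.IsLink a p q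
  symm := ⟨fun _ _ ⟨h, a, ha, hl⟩ => ⟨h.symm, a, ha, hl.symm⟩⟩
  loopless := ⟨fun _ h => h.1 rfl⟩

theorem adjVia_mono {F F' : Set δ} (h : F ⊆ F') : Q.adjVia F ≤ Q.adjVia F' :=
  fun _ _ ⟨hne, a, ha, hl⟩ => ⟨hne, a, h ha, hl⟩

/-- A loopless connected graph of genus one contains a cycle. -/
theorem IsConnected.exists_cycle (hQ : Q.IsConnected) (hV : V(Q).Finite)
    (hloop : ∀ a p q, Q.IsLink a p q → p ≠ q) (hg : Q.eulerGenus = 1) :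
    ∃ (m : ℕ) (p : ℕ → γ) (a : ℕ → δ), Set.InjOn p (Set.Iic m) ∧ Set.InjOn a (Set.Iic m) ∧
      (∀ i < m, Q.IsLink (a i) (p i) (p (i + 1))) ∧ Q.IsLink (a m) (p m) (p 0) := by
  have hcard : E(Q).ncard = V(Q).ncard := by
    unfold eulerGenus at hg
    omega
  obtain ⟨r, hr⟩ := hQ.1
  obtain ⟨F, hFE, hF, hc⟩ := hQ.exists_spanning hV
    (fun S F => ∀ x ∈ S, ∀ y ∈ S, (Q.adjVia F).Reachable x y)
    (by
      intro S F a p q hP hp hq hl _ x hx y hy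
      have hmono : Q.adjVia F ≤ Q.adjVia (insert a F) := adjVia_mono (Set.subset_insert a F)
      have hpq : (Q.adjVia (insert a F)).Reachable p q :=
        SimpleGraph.Adj.reachable ⟨hloop _ _ _ hl, a, Set.mem_insert _ _, hl⟩
      have key : ∀ z ∈ insert q S, (Q.adjVia (insert a F)).Reachable p z := by
        intro z hz
        rcases Set.mem_insert_iff.1 hz with rfl | hz
        · exact hpq
        · exact (hP p hp z hz).mono hmono
      exact (key x hx).symm.trans (key y hy))
    _ {r} ∅ rfl (by
      rintro x rfl y rfl
      exact SimpleGraph.Reachable.refl _) (Set.singleton_nonempty r)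
    (Set.singleton_subset_iff.2 hr) (Set.empty_subset _) Set.finite_empty (by simp)
  -- The spanning tree `F` has one edge fewer than `Q` has vertices, while `Q` has as many edges as
  -- vertices.
  obtain ⟨f, hfE, hfF⟩ : ∃ f ∈ E(Q), f ∉ F := by
    by_contra! h
    have : F = E(Q) := hFE.antisymm h
    rw [this, Set.ncard_singleton, Set.ncard_empty] at hc
    omega
  obtain ⟨x, y, hl⟩ := exists_isLink_of_mem_edgeSet hfE
  obtain ⟨w⟩ := hF x hl.left_mem y hl.right_mem
  classical
  have hpath := w.bypass_isPath
  set u := w.bypass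
  have hadj : ∀ i, i < u.length → ∃ a ∈ F, Q.IsLink a (u.getVert i) (u.getVert (i + 1)) :=
    fun i hi => (u.adj_getVert_succ hi).2
  have : Nonempty δ := ⟨f⟩
  choose! a haF hal using hadj
  have hinj := hpath.getVert_injOn
  refine ⟨u.length, u.getVert, fun i => if i < u.length then a i else f, ?_, ?_, ?_, ?_⟩
  · exact hinj
  · intro i hi j hj hij
    simp only [Set.mem_Iic] at hi hj
    dsimp only at hij
    split_ifs at hij with h₁ h₂ h₂
    · have hi' := hal i h₁
      rw [hij] at hi'
      rcases hi'.eq_and_eq_or_eq_and_eq (hal j h₂) with ⟨h, -⟩ | ⟨h, h'⟩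
      · exact hinj (by simp; omega) (by simp; omega) h
      -- An edge used in opposite directions would give both `i = j + 1` and `j = i + 1`.
      · have e1 := hinj (by simp; omega) (by simp; omega) h
        have e2 := hinj (by simp; omega) (by simp; omega) h'
        omega
    · exact absurd (hij ▸ haF i h₁) hfF
    · exact absurd (hij.symm ▸ haF j h₂) hfF
    · omega
  · intro i hi
    simp only [hi, if_true]
    exact hal i hi
  · simpa using hl.symm

end Cycle
end Graph
-- Orbits, and lifting edges from the quotient
namespace Graph
namespace MixingInvolution

variable {α β : Type*} {G : Graph α β} (ι : G.MixingInvolution)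

theorem orbitV_eq_orbitV_iff {x y : α} (hx : x ∈ V(G)) :
    ι.orbitV y = ι.orbitV x ↔ y = x ∨ y = ι.onV x := by
  constructor
  · intro h
    have : y ∈ ι.orbitV x := h ▸ Set.mem_insert y _
    simpa [orbitV] using this
  · rintro (rfl | rfl)
    · rfl
    · exact ι.orbitV_onV hx

theorem onE_mem {e : β} (he : e ∈ E(G)) : ι.onE e ∈ E(G) := by
  obtain ⟨x, y, h⟩ := exists_isLink_of_mem_edgeSet he
  exact (ι.map_isLink _ _ _ h).edge_mem

theorem orbitE_onE {e : β} (he : e ∈ E(G)) : ι.orbitE (ι.onE e) = ι.orbitE e := by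
  simp only [orbitE, ι.onE_onE e he, Set.pair_comm]

theorem orbitE_eq_orbitE_iff {e f : β} (he : e ∈ E(G)) :
    ι.orbitE f = ι.orbitE e ↔ f = e ∨ f = ι.onE e := by
  constructor
  · intro h
    have : f ∈ ι.orbitE e := h ▸ Set.mem_insert f _
    simpa [orbitE] using this
  · rintro (rfl | rfl)
    · rfl
    · exact ι.orbitE_onE he

theorem orbitV_mem_quotient {x : α} (hx : x ∈ V(G)) : ι.orbitV x ∈ V(ι.quotient) :=
  ⟨x, hx, rfl⟩

theorem quotient_isLink_ne {a : Set β} {p q : Set α} (h : ι.quotient.IsLink a p q) : p ≠ q := by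
  obtain ⟨_, _, _, _, _, _, _, h⟩ := h
  exact h

theorem quotient_isLink {e : β} {x y : α} (h : G.IsLink e x y) (hne : ι.orbitV x ≠ ι.orbitV y) :
    ι.quotient.IsLink (ι.orbitE e) (ι.orbitV x) (ι.orbitV y) :=
  ⟨e, x, y, h, rfl, rfl, rfl, hne⟩

/-- An edge of the quotient lifts to an edge from any vertex over its first end. -/
theorem exists_isLink_of_quotient {a : Set β} {p q : Set α} (h : ι.quotient.IsLink a p q) {x : α}
    (hx : x ∈ V(G)) (hxp : ι.orbitV x = p) :
    ∃ e y, G.IsLink e x y ∧ ι.orbitE e = a ∧ ι.orbitV y = q := by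
  obtain ⟨e, z, w, hl, rfl, rfl, rfl, -⟩ := h
  rcases (ι.orbitV_eq_orbitV_iff hl.left_mem).1 hxp with rfl | rfl
  · exact ⟨e, w, hl, rfl, rfl⟩
  · exact ⟨_, _, ι.map_isLink _ _ _ hl, ι.orbitE_onE hl.edge_mem, ι.orbitV_onV hl.right_mem⟩

/-- The mixing condition puts the ends of a fixed edge in one orbit. Hence each edge of the quotient
is covered by exactly two edges of `G`. -/
theorem onE_ne {e : β} {x y : α} (h : G.IsLink e x y) (hne : ι.orbitV x ≠ ι.orbitV y) :
    ι.onE e ≠ e := by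
  intro he
  apply hne
  rw [← ι.mixing e x y h he, ι.orbitV_onV h.left_mem]

theorem quotient_isConnected (hG : G.IsConnected) : ι.quotient.IsConnected := by
  refine ⟨hG.1.image _, ?_⟩
  rintro _ ⟨x, hx, rfl⟩ _ ⟨y, hy, rfl⟩
  have h := hG.2 x hx y hy
  clear hy
  induction h with
  | refl => exact Relation.ReflTransGen.refl
  | @tail y z _ h ih =>
    obtain ⟨e, he⟩ := h
    by_cases hyz : ι.orbitV y = ι.orbitV z
    · rwa [← hyz]
    · exact ih.tail ⟨_, ι.quotient_isLink he hyz⟩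

end MixingInvolution
end Graph
-- Drawings with free discs, and redrawing inside one disc
namespace Graph

/-- The points of a drawing: vertices, points on edges, and points of the free discs that join the
two members of a vertex orbit. -/
inductive Spot (α β : Type*) where
  | vert (x : α)
  | edge (e : β) (t : ℝ)
  | lens (p : Set α) (t h : ℝ)

namespace MixingInvolution

variable {α β : Type*} {G : Graph α β} (ι : G.MixingInvolution)

/-- The points to be drawn when the vertex orbits in `S` and the edges in `A` are drawn. -/
def spots (S : Set (Set α)) (A : Set β) : Set (Spot α β) := fun s =>
  match s with
  | .vert x => x ∈ V(G) ∧ ι.orbitV x ∈ S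
  | .edge e t => e ∈ A ∧ 0 < t ∧ t < 1
  | .lens p t h => p ∈ S ∧ 0 < t ∧ t < 1 ∧ 0 ≤ h ∧ h ≤ 1

@[simp] theorem vert_mem_spots {S : Set (Set α)} {A : Set β} {x : α} :
    Spot.vert x ∈ ι.spots S A ↔ x ∈ V(G) ∧ ι.orbitV x ∈ S := Iff.rfl

@[simp] theorem edge_mem_spots {S : Set (Set α)} {A : Set β} {e : β} {t : ℝ} :
    Spot.edge e t ∈ ι.spots S A ↔ e ∈ A ∧ 0 < t ∧ t < 1 := Iff.rfl

@[simp] theorem lens_mem_spots {S : Set (Set α)} {A : Set β} {p : Set α} {t h : ℝ} :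
    Spot.lens p t h ∈ ι.spots S A ↔ p ∈ S ∧ 0 < t ∧ t < 1 ∧ 0 ≤ h ∧ h ≤ 1 := Iff.rfl

/-- A drawing of the part of `G` with the vertex orbits in `S` and the edges in `A`, in which every
drawn orbit `{x, ι x}` comes with a free disc pinched at the two (possibly equal) points. -/
structure IsDrawing {X : Type*} [TopologicalSpace X] (S : Set (Set α)) (A : Set β)
    (Φ : Spot α β → X) : Prop where
  inj : Set.InjOn Φ (ι.spots S A)
  cont_edge : ∀ e ∈ A, Continuous fun t => Φ (.edge e t)
  cont_lens : ∀ p ∈ S, Continuous fun y : ℝ × ℝ => Φ (.lens p y.1 y.2)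
  edge_ends : ∀ e ∈ A, ∃ x y, G.IsLink e x y ∧ ι.orbitV x ∈ S ∧ ι.orbitV y ∈ S ∧
    Φ (.edge e 0) = Φ (.vert x) ∧ Φ (.edge e 1) = Φ (.vert y)
  lens_ends : ∀ p ∈ S, ∃ x ∈ V(G), ι.orbitV x = p ∧
    ∀ h, Φ (.lens p 0 h) = Φ (.vert x) ∧ Φ (.lens p 1 h) = Φ (.vert (ι.onV x))

variable {ι} {X : Type*} [TopologicalSpace X] {S : Set (Set α)} {A : Set β} {Φ : Spot α β → X}

/-- A drawing of all vertices and all edges gives an embedding. -/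
theorem IsDrawing.nonempty_embedding {X : Type} [TopologicalSpace X] [Nonempty X]
    {Φ : Spot α β → X} (hΦ : ι.IsDrawing V(ι.quotient) E(G) Φ) : Nonempty (G.Embedding X) := by
  have hv : ∀ x ∈ V(G), Spot.vert x ∈ ι.spots V(ι.quotient) E(G) :=
    fun x hx => ⟨hx, ι.orbitV_mem_quotient hx⟩
  have hmem : ∀ e ∈ E(G), ∀ t ∈ Set.Ioo (0 : unitInterval) 1,
      Spot.edge e (t : ℝ) ∈ ι.spots V(ι.quotient) E(G) :=
    fun e he t ht => ⟨he, by exact_mod_cast ht.1, by exact_mod_cast ht.2⟩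
  -- An embedding assigns a curve to every element of `β`; a constant curve serves outside `E(G)`.
  have hex : ∀ e, ∃ γ : C(unitInterval, X), e ∈ E(G) → ∀ t, γ t = Φ (.edge e (t : ℝ)) := by
    intro e
    by_cases he : e ∈ E(G)
    · exact ⟨⟨_, (hΦ.cont_edge e he).comp continuous_subtype_val⟩, fun _ _ => rfl⟩
    · exact ⟨.const _ (Classical.arbitrary X), fun h => absurd h he⟩
  choose γ hγ using hex
  refine ⟨⟨fun x => Φ (.vert x), γ, ?_, ?_, ?_, ?_, ?_⟩⟩
  · intro x hx y hy h
    simpa using hΦ.inj (hv x hx) (hv y hy) h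
  · intro e he
    obtain ⟨x, y, hl, -, -, h0, h1⟩ := hΦ.edge_ends e he
    exact ⟨x, y, hl, by simpa [hγ e he] using h0, by simpa [hγ e he] using h1⟩
  · intro e he s hs t ht h
    rw [hγ e he, hγ e he] at h
    simpa [Subtype.ext_iff] using hΦ.inj (hmem e he s hs) (hmem e he t ht) h
  · intro e he t ht x hx h
    rw [hγ e he] at h
    simpa using hΦ.inj (hmem e he t ht) (hv x hx) h
  · intro e he f hf hne s hs t ht h
    rw [hγ e he, hγ f hf] at h
    have := hΦ.inj (hmem e he s hs) (hmem f hf t ht) h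
    simp only [Spot.edge.injEq] at this
    exact hne this.1

/-- The points that are drawn when vertex orbits in `T` and edges in `B` are added inside the free
disc of `p`. -/
def newSpots (ι : G.MixingInvolution) (p : Set α) (T : Set (Set α)) (B : Set β) :
    Set (Spot α β) := fun s =>
  match s with
  | .vert x => x ∈ V(G) ∧ ι.orbitV x ∈ T
  | .edge e t => e ∈ B ∧ 0 < t ∧ t < 1
  -- The disc of `p` counts as new: it is replaced by a smaller one, to make room.
  | .lens q t h => (q = p ∨ q ∈ T) ∧ 0 < t ∧ t < 1 ∧ 0 ≤ h ∧ h ≤ 1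

open Classical in
/-- The drawing obtained from `Φ` by redrawing the free disc of `p` according to `u`. -/
noncomputable def extendDrawing (ι : G.MixingInvolution) (Φ : Spot α β → X) (p : Set α)
    (T : Set (Set α)) (B : Set β) (u : Spot α β → ℝ × ℝ) (s : Spot α β) : X :=
  match s with
  | .vert x => if ι.orbitV x ∈ T then Φ (.lens p (u (.vert x)).1 (u (.vert x)).2) else Φ (.vert x)
  | .edge e t => if e ∈ B then Φ (.lens p (u (.edge e t)).1 (u (.edge e t)).2) else Φ (.edge e t)
  | .lens q t h => if q = p ∨ q ∈ T then Φ (.lens p (u (.lens q t h)).1 (u (.lens q t h)).2)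
      else Φ (.lens q t h)

/-- Vertices, edges and free discs drawn inside the free disc of `p` extend a drawing. -/
theorem IsDrawing.extend (hΦ : ι.IsDrawing S A Φ) {p : Set α} (hp : p ∈ S) {T : Set (Set α)}
    {B : Set β} (hT : Disjoint S T) (hB : Disjoint A B) (u : Spot α β → ℝ × ℝ)
    (hu : ∀ s ∈ newSpots ι p T B, 0 < (u s).1 ∧ (u s).1 < 1 ∧ 0 ≤ (u s).2 ∧ (u s).2 ≤ 1)
    (hinj : Set.InjOn u (newSpots ι p T B))
    (hce : ∀ e ∈ B, Continuous fun t => u (.edge e t))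
    (hcl : ∀ q, q = p ∨ q ∈ T → Continuous fun y : ℝ × ℝ => u (.lens q y.1 y.2))
    (hee : ∀ e ∈ B, ∃ x y, G.IsLink e x y ∧ ι.orbitV x ∈ S ∪ T ∧ ι.orbitV y ∈ S ∪ T ∧
      Φ (.lens p (u (.edge e 0)).1 (u (.edge e 0)).2) = ι.extendDrawing Φ p T B u (.vert x) ∧
      Φ (.lens p (u (.edge e 1)).1 (u (.edge e 1)).2) = ι.extendDrawing Φ p T B u (.vert y))
    (hle : ∀ q, q = p ∨ q ∈ T → ∃ x ∈ V(G), ι.orbitV x = q ∧ ∀ h,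
      Φ (.lens p (u (.lens q 0 h)).1 (u (.lens q 0 h)).2) =
        ι.extendDrawing Φ p T B u (.vert x) ∧
      Φ (.lens p (u (.lens q 1 h)).1 (u (.lens q 1 h)).2) =
        ι.extendDrawing Φ p T B u (.vert (ι.onV x))) :
    ι.IsDrawing (S ∪ T) (A ∪ B) (ι.extendDrawing Φ p T B u) := by
  have hST : ∀ q ∈ S, q ∉ T := fun q h h' => Set.disjoint_left.1 hT h h'
  have hAB : ∀ e ∈ A, e ∉ B := fun q h h' => Set.disjoint_left.1 hB h h'
  have hnew : ∀ s ∈ newSpots ι p T B,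
      ι.extendDrawing Φ p T B u s = Φ (.lens p (u s).1 (u s).2) := by
    rintro (x | ⟨e, t⟩ | ⟨q, t, h⟩) hs
    · exact if_pos hs.2
    · exact if_pos hs.1
    · exact if_pos hs.1
  -- Surviving old points lie outside the disc of `p`, so they cannot meet anything drawn inside it.
  have hold : ∀ s ∈ ι.spots (S ∪ T) (A ∪ B), s ∉ newSpots ι p T B →
      ι.extendDrawing Φ p T B u s = Φ s ∧ s ∈ ι.spots S A ∧
        ∀ t h, s ≠ .lens p t h := by
    rintro (x | ⟨e, t⟩ | ⟨q, t, h⟩) hs hn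
    · have h1 : ι.orbitV x ∉ T := fun h => hn ⟨hs.1, h⟩
      exact ⟨if_neg h1, ⟨hs.1, hs.2.resolve_right h1⟩, by simp⟩
    · have h1 : e ∉ B := fun h => hn ⟨h, hs.2⟩
      exact ⟨if_neg h1, ⟨hs.1.resolve_right h1, hs.2⟩, by simp⟩
    · have h1 : ¬ (q = p ∨ q ∈ T) := fun h => hn ⟨h, hs.2⟩
      refine ⟨if_neg h1, ⟨hs.1.resolve_right fun h => h1 (Or.inr h), hs.2⟩, ?_⟩
      intro t' h' heq
      simp only [Spot.lens.injEq] at heq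
      exact h1 (Or.inl heq.1)
  have hlens : ∀ s ∈ newSpots ι p T B, Spot.lens p (u s).1 (u s).2 ∈ ι.spots S A :=
    fun s hs => ⟨hp, hu s hs⟩
  refine ⟨?_, ?_, ?_, ?_, ?_⟩
  · intro s hs s' hs' h
    by_cases h1 : s ∈ newSpots ι p T B <;> by_cases h2 : s' ∈ newSpots ι p T B
    · rw [hnew s h1, hnew s' h2] at h
      have h3 := hΦ.inj (hlens s h1) (hlens s' h2) h
      simp only [Spot.lens.injEq, true_and] at h3
      exact hinj h1 h2 (Prod.ext h3.1 h3.2)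
    · obtain ⟨h3, h4, h5⟩ := hold s' hs' h2
      rw [hnew s h1, h3] at h
      exact absurd (hΦ.inj (hlens s h1) h4 h).symm (h5 _ _)
    · obtain ⟨h3, h4, h5⟩ := hold s hs h1
      rw [hnew s' h2, h3] at h
      exact absurd (hΦ.inj h4 (hlens s' h2) h) (h5 _ _)
    · obtain ⟨h3, h4, -⟩ := hold s hs h1
      obtain ⟨h5, h6, -⟩ := hold s' hs' h2
      rw [h3, h5] at h
      exact hΦ.inj h4 h6 h
  · intro e he
    by_cases heB : e ∈ B
    · simp only [extendDrawing, if_pos heB]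
      exact (hΦ.cont_lens p hp).comp (hce e heB)
    · simp only [extendDrawing, if_neg heB]
      exact hΦ.cont_edge e (he.resolve_right heB)
  · intro q hq
    by_cases hqT : q = p ∨ q ∈ T
    · simp only [extendDrawing, if_pos hqT]
      exact (hΦ.cont_lens p hp).comp (hcl q hqT)
    · simp only [extendDrawing, if_neg hqT]
      exact hΦ.cont_lens q (hq.resolve_right fun h => hqT (Or.inr h))
  · intro e he
    by_cases heB : e ∈ B
    · obtain ⟨x, y, h⟩ := hee e heB
      refine ⟨x, y, ?_⟩
      rw [show ι.extendDrawing Φ p T B u (.edge e 0) = _ from if_pos heB,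
        show ι.extendDrawing Φ p T B u (.edge e 1) = _ from if_pos heB]
      exact h
    · obtain ⟨x, y, hl, hx, hy, h0, h1⟩ := hΦ.edge_ends e (he.resolve_right heB)
      refine ⟨x, y, hl, Or.inl hx, Or.inl hy, ?_, ?_⟩
      · simpa only [extendDrawing, if_neg heB, if_neg (hST _ hx)] using h0
      · simpa only [extendDrawing, if_neg heB, if_neg (hST _ hy)] using h1
  · intro q hq
    by_cases hqT : q = p ∨ q ∈ T
    · obtain ⟨x, hx, hxq, h⟩ := hle q hqT
      refine ⟨x, hx, hxq, fun k => ?_⟩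
      rw [show ι.extendDrawing Φ p T B u (.lens q 0 k) = _ from if_pos hqT,
        show ι.extendDrawing Φ p T B u (.lens q 1 k) = _ from if_pos hqT]
      exact h k
    · have hqS : q ∈ S := hq.resolve_right fun h => hqT (Or.inr h)
      obtain ⟨x, hx, hxq, h⟩ := hΦ.lens_ends q hqS
      refine ⟨x, hx, hxq, fun k => ?_⟩
      have h1 : ι.orbitV x ∉ T := hxq ▸ hST q hqS
      have h2 : ι.orbitV (ι.onV x) ∉ T := by rwa [ι.orbitV_onV hx]
      simpa only [extendDrawing, if_neg hqT, if_neg h1, if_neg h2] using h k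

end MixingInvolution
end Graph
-- Adding edges within an orbit and pendant orbits
namespace Graph
namespace MixingInvolution

variable {α β : Type*} {G : Graph α β} {ι : G.MixingInvolution}
  {X : Type*} [TopologicalSpace X] {S : Set (Set α)} {A : Set β} {Φ : Spot α β → X}

/-- An edge can be drawn along a curve in one half of a free disc. -/
theorem IsDrawing.insert_edge (hΦ : ι.IsDrawing S A Φ) {e : β} (he : e ∉ A) {x y : α}
    (hl : G.IsLink e x y) (hx : ι.orbitV x ∈ S) (hy : ι.orbitV y ∈ S) {p : Set α} (hp : p ∈ S)
    (γ : ℝ → ℝ × ℝ) (hγ : Continuous γ)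
    (hγ' : ∀ t, 0 < t → t < 1 → 0 < (γ t).1 ∧ (γ t).1 < 1 ∧ 1 / 2 < (γ t).2 ∧ (γ t).2 ≤ 1)
    (hinj : Function.Injective γ)
    (h0 : Φ (.lens p (γ 0).1 (γ 0).2) = Φ (.vert x))
    (h1 : Φ (.lens p (γ 1).1 (γ 1).2) = Φ (.vert y)) :
    ∃ Ψ : Spot α β → X, ι.IsDrawing S (insert e A) Ψ := by
  -- The free disc is squeezed into the half with second coordinate at most `1/2`; the curve `γ`
  -- runs in the other half.
  let u : Spot α β → ℝ × ℝ := fun s =>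
    match s with
    | .vert _ => 0
    | .edge _ t => γ t
    | .lens _ t h => (t, h / 2)
  have := hΦ.extend hp (T := ∅) (B := {e}) (Set.disjoint_empty S)
    (Set.disjoint_singleton_right.2 he) u ?_ ?_ ?_ ?_ ?_ ?_
  · rw [Set.union_empty, Set.union_singleton] at this
    exact ⟨_, this⟩
  · rintro (x | ⟨f, t⟩ | ⟨q, t, h⟩) hs
    · exact absurd hs.2 (Set.notMem_empty _)
    · obtain ⟨h2, h3, h4, h5⟩ := hγ' t hs.2.1 hs.2.2
      exact ⟨h2, h3, by change 0 ≤ (γ t).2; linarith, h5⟩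
    · obtain ⟨-, h2, h3, h4, h5⟩ := hs
      exact ⟨h2, h3, by change 0 ≤ h / 2; linarith, by change h / 2 ≤ 1; linarith⟩
  · rintro (x | ⟨f, t⟩ | ⟨q, t, h⟩) hs (x' | ⟨f', t'⟩ | ⟨q', t', h'⟩) hs' heq
    any_goals exact absurd hs.2 (Set.notMem_empty _)
    any_goals exact absurd hs'.2 (Set.notMem_empty _)
    · obtain ⟨rfl, -⟩ := hs
      obtain ⟨rfl, -⟩ := hs'
      change γ t = γ t' at heq
      rw [hinj heq]
    · have h2 := (hγ' t hs.2.1 hs.2.2).2.2.1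
      have h3 : (γ t).2 = h' / 2 := congrArg Prod.snd heq
      have := hs'.2.2.2.2
      linarith
    · have h2 := (hγ' t' hs'.2.1 hs'.2.2).2.2.1
      have h3 : h / 2 = (γ t').2 := congrArg Prod.snd heq
      have := hs.2.2.2.2
      linarith
    · have h2 : q = p := by simpa using hs.1
      have h3 : q' = p := by simpa using hs'.1
      have h4 : t = t' := congrArg Prod.fst heq
      have h5 : h / 2 = h' / 2 := congrArg Prod.snd heq
      rw [h2, h3, h4, show h = h' by linarith]
  · exact fun _ _ => hγ
  · intro q _
    exact continuous_fst.prodMk (continuous_snd.div_const 2)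
  · rintro f rfl
    refine ⟨x, y, hl, Or.inl hx, Or.inl hy, ?_, ?_⟩
    · simpa [extendDrawing] using h0
    · simpa [extendDrawing] using h1
  · intro q hq
    obtain rfl : q = p := by simpa using hq
    obtain ⟨z, hz, hzp, h⟩ := hΦ.lens_ends q hp
    refine ⟨z, hz, hzp, fun k => ?_⟩
    simpa [extendDrawing] using h (k / 2)

/-- An edge between two vertices of a drawn orbit can be added to a drawing. -/
theorem IsDrawing.insert_vertical (hΦ : ι.IsDrawing S A Φ) {e : β} (he : e ∉ A) {x y : α}
    (hl : G.IsLink e x y) (hx : ι.orbitV x ∈ S) (hxy : ι.orbitV x = ι.orbitV y) :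
    ∃ Ψ : Spot α β → X, ι.IsDrawing S (insert e A) Ψ := by
  obtain ⟨z, hz, hzx, hends⟩ := hΦ.lens_ends _ hx
  have hx' := (ι.orbitV_eq_orbitV_iff hz).1 hzx.symm
  have hy' := (ι.orbitV_eq_orbitV_iff hz).1 (hxy.symm.trans hzx.symm)
  have hrung : ∀ {x y : α}, G.IsLink e x y → ι.orbitV x ∈ S → ι.orbitV y ∈ S → x = z →
      y = ι.onV z → ∃ Ψ : Spot α β → X, ι.IsDrawing S (insert e A) Ψ := by
    rintro _ _ hl hxS hyS rfl rfl
    refine hΦ.insert_edge he hl hxS hyS hx (fun t => (t, 3 / 4)) (by fun_prop) ?_ ?_ ?_ ?_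
    · intro t h0 h1
      exact ⟨h0, h1, by norm_num, by norm_num⟩
    · intro s t h
      exact congrArg Prod.fst h
    · exact (hends _).1
    · exact (hends _).2
  have hy : ι.orbitV y ∈ S := hxy ▸ hx
  have hpos : ∀ t : ℝ, 0 < t → t < 1 → 0 < t * (1 - t) ∧ t * (1 - t) < 1 := by
    intro t h0 h1
    constructor <;> nlinarith
  have hsnd : ∀ s t : ℝ, (3 + s) / 4 = (3 + t) / 4 → s = t := fun s t h => by linarith
  rcases hx' with rfl | rfl <;> rcases hy' with rfl | rfl
  -- A loop leaves the pinched end `t = 0` and returns to it. The second coordinate increases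
  -- strictly, which makes the curve injective even though its two ends are one point of the torus
  -- drawing.
  · refine hΦ.insert_edge he hl hx hx hx (fun t => (t * (1 - t), (3 + t) / 4)) (by fun_prop)
      ?_ ?_ ?_ ?_
    · intro t h0 h1
      exact ⟨(hpos t h0 h1).1, (hpos t h0 h1).2, by dsimp only; linarith, by dsimp only; linarith⟩
    · intro s t h
      exact hsnd s t (congrArg Prod.snd h)
    · simpa using (hends _).1
    · simpa using (hends _).1
  · exact hrung hl hx hy rfl rfl
  · exact hrung hl.symm hy hx rfl rfl
  · refine hΦ.insert_edge he hl hx hx hx (fun t => (1 - t * (1 - t), (3 + t) / 4)) (by fun_prop)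
      ?_ ?_ ?_ ?_
    · intro t h0 h1
      have := hpos t h0 h1
      refine ⟨?_, ?_, ?_, ?_⟩ <;> dsimp only <;> linarith
    · intro s t h
      exact hsnd s t (congrArg Prod.snd h)
    · simpa using (hends _).2
    · simpa using (hends _).2

/-- All edges between vertices of the same orbit can be added to a drawing. -/
theorem IsDrawing.insert_verticals (hΦ : ι.IsDrawing S A Φ) {B : Set β} (hB : B.Finite)
    (h : ∀ e ∈ B, ∃ x y, G.IsLink e x y ∧ ι.orbitV x ∈ S ∧ ι.orbitV x = ι.orbitV y) :
    ∃ Ψ : Spot α β → X, ι.IsDrawing S (A ∪ B) Ψ := by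
  induction B, hB using Set.Finite.induction_on with
  | empty => exact ⟨Φ, by rwa [Set.union_empty]⟩
  | @insert e B _ _ ih =>
    obtain ⟨Ψ, hΨ⟩ := ih fun f hf => h f (Set.mem_insert_of_mem _ hf)
    by_cases he : e ∈ A ∪ B
    · refine ⟨Ψ, ?_⟩
      rwa [Set.union_insert, Set.insert_eq_of_mem he]
    · obtain ⟨x, y, hl, hx, hxy⟩ := h e (Set.mem_insert _ _)
      rw [Set.union_insert]
      exact hΨ.insert_vertical he hl hx hxy

/-- The second coordinate determines `w = (1 + h) * (t * (1 - t))`. For fixed `w > 0` the first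
coordinate is affine in `t` with slope `(b - a) + w / 4 > 0`, even when `a = b`; then `w` and `t`
determine `h`. -/
theorem leaf_lens_injective {a b t h t' h' : ℝ} (hab : a ≤ b) (ht0 : 0 < t) (ht1 : t < 1)
    (hh0 : 0 ≤ h)
    (h1 : a + (b - a) * t + (1 + h) * (t * (1 - t)) * (2 * t - 1) / 8 =
      a + (b - a) * t' + (1 + h') * (t' * (1 - t')) * (2 * t' - 1) / 8)
    (h2 : 3 / 4 + (1 + h) * (t * (1 - t)) / 8 = 3 / 4 + (1 + h') * (t' * (1 - t')) / 8) :
    t = t' ∧ h = h' := by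
  have hpos : 0 < t * (1 - t) := mul_pos ht0 (by linarith)
  have hw : (1 + h) * (t * (1 - t)) = (1 + h') * (t' * (1 - t')) := by linarith
  have hw0 : 0 < (1 + h) * (t * (1 - t)) := mul_pos (by linarith) hpos
  rw [← hw] at h1
  have h3 : (t - t') * ((b - a) + (1 + h) * (t * (1 - t)) / 4) = 0 := by linear_combination h1
  have h4 : (b - a) + (1 + h) * (t * (1 - t)) / 4 ≠ 0 := by
    have : 0 ≤ b - a := by linarith
    positivity
  obtain rfl : t = t' := by
    have := (mul_eq_zero.1 h3).resolve_right h4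
    linarith
  refine ⟨rfl, ?_⟩
  have := mul_right_cancel₀ hpos.ne' hw
  linarith

open Classical in
/-- The position, inside the free disc of a neighbouring orbit `p`, of a pendant orbit
`{z, ι z}` with the edges that join it to `p`. -/
noncomputable def leafPos (p : Set α) (z : α) (e : β) (a b : ℝ) (s : Spot α β) : ℝ × ℝ :=
  match s with
  | .vert v => (if v = z then a else b, 3 / 4)
  | .edge f t => (if f = e then a * t else b + (1 - b) * t, 3 / 4)
  | .lens q t h => if q = p then (t, h / 2) else
      -- The term with `2 * t - 1` opens the disc sideways. Without it, the disc would collapse onto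
      -- a segment when `a = b`, that is, when `z` is fixed.
      (a + (b - a) * t + (1 + h) * (t * (1 - t)) * (2 * t - 1) / 8,
        3 / 4 + (1 + h) * (t * (1 - t)) / 8)

/-- The new disc deviates by at most `1/16` in each coordinate from the segment between `a` and `b`
at height `3/4`, so keeping `a` and `b` in `[1/3, 2/3]` is ample. -/
theorem leafPos_mem {p : Set α} {z : α} {e : β} {a b : ℝ} (ha : 1 / 3 ≤ a) (hab : a ≤ b)
    (hb : b ≤ 2 / 3) {T : Set (Set α)} {B : Set β} (s : Spot α β)
    (hs : s ∈ newSpots ι p T B) :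
    0 < (leafPos p z e a b s).1 ∧ (leafPos p z e a b s).1 < 1 ∧
      0 ≤ (leafPos p z e a b s).2 ∧ (leafPos p z e a b s).2 ≤ 1 := by
  rcases s with v | ⟨f, t⟩ | ⟨q, t, h⟩
  · simp only [leafPos]
    split_ifs <;> refine ⟨?_, ?_, ?_, ?_⟩ <;> linarith
  · obtain ⟨-, h0, h1⟩ := hs
    simp only [leafPos]
    split_ifs <;> refine ⟨?_, ?_, ?_, ?_⟩ <;> nlinarith
  · obtain ⟨-, h0, h1, h2, h3⟩ := hs
    simp only [leafPos]
    split_ifs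
    · refine ⟨?_, ?_, ?_, ?_⟩ <;> dsimp only <;> linarith
    · have hw0 : 0 < t * (1 - t) := mul_pos h0 (by linarith)
      have hw1 : t * (1 - t) ≤ 1 / 4 := by nlinarith [sq_nonneg (t - 1 / 2)]
      have hu0 : 0 < (1 + h) * (t * (1 - t)) := by positivity
      have hu1 : (1 + h) * (t * (1 - t)) ≤ 1 / 2 := by nlinarith
      set w := (1 + h) * (t * (1 - t))
      have h4 : -(1 / 2) ≤ w * (2 * t - 1) := by nlinarith
      have h5 : w * (2 * t - 1) ≤ 1 / 2 := by nlinarith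
      have h6 : 0 ≤ (b - a) * t := mul_nonneg (by linarith) h0.le
      have h7 : (b - a) * t ≤ b - a := by nlinarith
      refine ⟨?_, ?_, ?_, ?_⟩ <;> dsimp only <;> linarith

/-- Three levels are disjoint: the old disc up to `1/2`, the vertices and edges at `3/4`, the new
disc strictly above `3/4`. Along `3/4` come the edge `e` on `(0, a)`, then `a`, `b`, then `ι e` on
`(b, 1)`. -/
theorem leafPos_injOn {p : Set α} {z : α} {e : β} {a b : ℝ} (ha : 1 / 3 ≤ a) (hab : a ≤ b)
    (hb : b ≤ 2 / 3) (heq : a = b → ι.onV z = z) (hz : z ∈ V(G)) :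
    Set.InjOn (leafPos p z e a b) (newSpots ι p {ι.orbitV z} {e, ι.onE e}) := by
  have hw : ∀ t h : ℝ, 0 < t → t < 1 → 0 ≤ h → 0 < (1 + h) * (t * (1 - t)) :=
    fun t h h0 h1 h2 => mul_pos (by linarith) (mul_pos h0 (by linarith))
  have key : ∀ v f t, Spot.vert v ∈ newSpots ι p {ι.orbitV z} {e, ι.onE e} →
      Spot.edge f t ∈ newSpots ι p {ι.orbitV z} {e, ι.onE e} →
      leafPos p z e a b (.vert v) ≠ leafPos p z e a b (.edge f t) := by
    rintro v f t - ⟨-, h0, h1⟩ h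
    have := congrArg Prod.fst h
    simp only [leafPos] at this
    split_ifs at this <;> nlinarith
  have key' : ∀ c q t h, Spot.lens q t h ∈ newSpots ι p {ι.orbitV z} {e, ι.onE e} →
      (c, 3 / 4) ≠ leafPos p z e a b (.lens q t h) := by
    rintro c q t h ⟨-, h0, h1, h2, h3⟩ h
    have := congrArg Prod.snd h
    have := hw t _ h0 h1 h2
    simp only [leafPos] at *
    split_ifs at * <;> dsimp only at * <;> linarith
  rintro (v | ⟨f, t⟩ | ⟨q, t, h⟩) hs (v' | ⟨f', t'⟩ | ⟨q', t', h'⟩) hs' hu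
  · have h1 := (ι.orbitV_eq_orbitV_iff hz).1 hs.2
    have h2 := (ι.orbitV_eq_orbitV_iff hz).1 hs'.2
    have h3 := congrArg Prod.fst hu
    simp only [leafPos] at h3
    split_ifs at h3 with h4 h5 h5
    · rw [h4, h5]
    · rw [h4, h2.resolve_left h5, heq h3]
    · rw [h5, h1.resolve_left h4, heq h3.symm]
    · rw [h1.resolve_left h4, h2.resolve_left h5]
  · exact absurd hu (key _ _ _ hs hs')
  · exact absurd hu (key' _ _ _ _ hs')
  · exact absurd hu.symm (key _ _ _ hs' hs)
  · obtain ⟨h1, h2, h3⟩ := hs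
    obtain ⟨h1', h2', h3'⟩ := hs'
    have h4 := congrArg Prod.fst hu
    simp only [leafPos] at h4
    simp only [Set.mem_insert_iff, Set.mem_singleton_iff] at h1 h1'
    split_ifs at h4 with h5 h6 h6
    · rw [h5, h6, mul_left_cancel₀ (by linarith) h4]
    · nlinarith
    · nlinarith
    · rw [h1.resolve_left h5, h1'.resolve_left h6,
        mul_left_cancel₀ (by linarith : 1 - b ≠ 0) (add_left_cancel h4)]
  · exact absurd hu (key' _ _ _ _ hs')
  · exact absurd hu.symm (key' _ _ _ _ hs)
  · exact absurd hu.symm (key' _ _ _ _ hs)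
  · obtain ⟨h1, h2, h3, h4, h5⟩ := hs
    obtain ⟨h1', h2', h3', h4', h5'⟩ := hs'
    have h6 := congrArg Prod.fst hu
    have h7 := congrArg Prod.snd hu
    have h8 := hw t h h2 h3 h4
    have h8' := hw t' h' h2' h3' h4'
    simp only [leafPos] at h6 h7
    split_ifs at h6 h7 with h9 h10 h10 <;> dsimp only at h6 h7
    · rw [h9, h10, h6, show h = h' by linarith]
    · linarith
    · linarith
    · obtain ⟨rfl, rfl⟩ := leaf_lens_injective hab h2 h3 h4 h6 h7
      rw [h1.resolve_left h9, h1'.resolve_left h10]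

open Classical in
theorem IsDrawing.insert_leaf_aux (hΦ : ι.IsDrawing S A Φ) {e : β} {x z : α}
    (hl : G.IsLink e x z) (hx : ι.orbitV x ∈ S)
    (hends : ∀ h, Φ (.lens (ι.orbitV x) 0 h) = Φ (.vert x) ∧
      Φ (.lens (ι.orbitV x) 1 h) = Φ (.vert (ι.onV x)))
    (hz : ι.orbitV z ∉ S) (he : e ∉ A) (he' : ι.onE e ∉ A) :
    ∃ Ψ : Spot α β → X, ι.IsDrawing (insert (ι.orbitV z) S) (A ∪ {e, ι.onE e}) Ψ := by
  obtain ⟨a, b, ha, hab, hb, heq⟩ : ∃ a b : ℝ, 1 / 3 ≤ a ∧ a ≤ b ∧ b ≤ 2 / 3 ∧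
      (a = b ↔ ι.onV z = z) := by
    by_cases h : ι.onV z = z
    · exact ⟨1 / 2, 1 / 2, by norm_num, le_rfl, by norm_num, by simpa using h⟩
    · refine ⟨1 / 3, 2 / 3, le_rfl, by norm_num, le_rfl, ?_⟩
      norm_num [h]
  have hzV := hl.right_mem
  have hzx : ι.orbitV z ≠ ι.orbitV x := fun h => hz (h ▸ hx)
  have hne : ι.onE e ≠ e := ι.onE_ne hl hzx.symm
  have hx' : ι.orbitV (ι.onV x) = ι.orbitV x := ι.orbitV_onV hl.left_mem
  have hz' : ι.orbitV (ι.onV z) = ι.orbitV z := ι.orbitV_onV hzV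
  have hb' : (if ι.onV z = z then a else b) = b := by
    split_ifs with h
    · exact heq.2 h
    · rfl
  have := hΦ.extend hx (T := {ι.orbitV z}) (B := {e, ι.onE e})
    (Set.disjoint_singleton_right.2 hz) (by simp [he, he'])
    (leafPos (ι.orbitV x) z e a b) (fun s hs => leafPos_mem ha hab hb s hs)
    (leafPos_injOn ha hab hb heq.1 hzV) ?_ ?_ ?_ ?_
  · rw [Set.union_singleton] at this
    exact ⟨_, this⟩
  · intro f _
    simp only [leafPos]
    split_ifs <;> fun_prop
  · intro q _
    simp only [leafPos]
    split_ifs <;> fun_prop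
  · rintro f (rfl | rfl)
    · refine ⟨x, z, hl, Or.inl hx, Or.inr rfl, ?_, ?_⟩
      · simpa [extendDrawing, leafPos, hzx.symm] using (hends _).1
      · simp [extendDrawing, leafPos]
    · refine ⟨ι.onV z, ι.onV x, (ι.map_isLink _ _ _ hl).symm, Or.inr hz', Or.inl (hx'.symm ▸ hx),
        ?_, ?_⟩
      · simp [extendDrawing, leafPos, hne, hz', hb']
      · simpa [extendDrawing, leafPos, hne, hx', hzx.symm] using (hends _).2
  · rintro q (rfl | rfl)
    · refine ⟨x, hl.left_mem, rfl, fun h => ?_⟩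
      simpa [extendDrawing, leafPos, hx', hzx.symm] using hends (h / 2)
    · refine ⟨z, hzV, rfl, fun h => ?_⟩
      simp [extendDrawing, leafPos, hz', hb', hzx]

/-- A pendant orbit and the two edges that join it to a drawn orbit can be added to a drawing. -/
theorem IsDrawing.insert_leaf (hΦ : ι.IsDrawing S A Φ) {e : β} {x z : α}
    (hl : G.IsLink e x z) (hx : ι.orbitV x ∈ S) (hz : ι.orbitV z ∉ S) (he : e ∉ A)
    (he' : ι.onE e ∉ A) :
    ∃ Ψ : Spot α β → X, ι.IsDrawing (insert (ι.orbitV z) S) (A ∪ {e, ι.onE e}) Ψ := by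
  obtain ⟨w, hw, hwx, hends⟩ := hΦ.lens_ends _ hx
  rcases (ι.orbitV_eq_orbitV_iff hw).1 hwx.symm with rfl | rfl
  · exact hΦ.insert_leaf_aux hl hx hends hz he he'
  -- If `x` is the far end of its disc, the partner edge starts at the near end and adds the same
  -- orbits.
  · have hl' := ι.map_isLink _ _ _ hl
    rw [ι.onV_onV w hw] at hl'
    rw [← hwx] at hx hends
    have hz' := ι.orbitV_onV hl.right_mem
    have := hΦ.insert_leaf_aux hl' hx hends (hz'.symm ▸ hz) he'
      (by rwa [ι.onE_onE e hl.edge_mem])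
    rwa [hz', ι.onE_onE e hl.edge_mem, Set.pair_comm] at this

end MixingInvolution
end Graph
-- The torus cut into vertical strips, and injectivity over a cycle
namespace Graph

theorem unitAddCircle_coe_eq_iff {x y : ℝ} :
    (x : UnitAddCircle) = (y : UnitAddCircle) ↔ ∃ k : ℤ, x - y = k := by
  rw [← sub_eq_zero, ← AddCircle.coe_sub, AddCircle.coe_eq_zero_iff]
  simp [eq_comm]

theorem ne_intCast_of_pos_of_lt_one {x : ℝ} (h0 : 0 < x) (h1 : x < 1) (k : ℤ) : x ≠ k := by
  rintro rfl
  have : 0 < k := by exact_mod_cast h0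
  have : k < 1 := by exact_mod_cast h1
  omega

/-- The point of the torus at height `y` and at relative position `σ` in the `i`-th of `m + 1`
vertical strips. -/
noncomputable def stripPoint (m i : ℕ) (σ y : ℝ) : Torus :=
  ((((i + σ) / (m + 1) : ℝ) : UnitAddCircle), (y : UnitAddCircle))

/-- Both `i + σ` and `j + σ'` lie in the fundamental domain `[0, m + 1)`, so the horizontal
coordinate loses nothing; only heights remain ambiguous modulo 1. -/
theorem stripPoint_eq {m i j : ℕ} {σ σ' y y' : ℝ} (hi : i ≤ m) (hj : j ≤ m) (h0 : 0 ≤ σ)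
    (h1 : σ < 1) (h0' : 0 ≤ σ') (h1' : σ' < 1)
    (h : stripPoint m i σ y = stripPoint m j σ' y') :
    i = j ∧ σ = σ' ∧ ∃ k : ℤ, y - y' = k := by
  obtain ⟨hx, hy⟩ := Prod.ext_iff.1 h
  refine ⟨?_, ?_, unitAddCircle_coe_eq_iff.1 hy⟩
  all_goals
    obtain ⟨k, hk⟩ := unitAddCircle_coe_eq_iff.1 hx
    have hm : (0 : ℝ) < m + 1 := by positivity
    have hi' : (i : ℝ) ≤ m := by exact_mod_cast hi
    have hj' : (j : ℝ) ≤ m := by exact_mod_cast hj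
    have hi0 : (0 : ℝ) ≤ i := Nat.cast_nonneg i
    have hj0 : (0 : ℝ) ≤ j := Nat.cast_nonneg j
    have hk' : (i + σ) - (j + σ') = k * (m + 1) := by
      rw [← hk]
      field_simp
    have hk1 : k < 1 := by
      have : (k : ℝ) < 1 := by
        by_contra! h
        nlinarith
      exact_mod_cast this
    have hk2 : -1 < k := by
      have : (-1 : ℝ) < k := by
        by_contra! h
        nlinarith
      exact_mod_cast this
    obtain rfl : k = 0 := by omega
    have hij : i = j := by
      have h2 : (i : ℝ) < j + 1 := by
        push_cast at hk'
        linarith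
      have h3 : (j : ℝ) < i + 1 := by
        push_cast at hk'
        linarith
      have h2' : i < j + 1 := by exact_mod_cast h2
      have h3' : j < i + 1 := by exact_mod_cast h3
      omega
  · exact hij
  · subst hij
    push_cast at hk'
    linarith

namespace MixingInvolution

variable {α β : Type*} {G : Graph α β} {ι : G.MixingInvolution}

open Classical in
/-- The drawing on the torus of the part of `G` over a cycle of the quotient: the `i`-th orbit lies
on the `i`-th meridian at heights `± H i`, and the two edges from it to the next orbit follow the
graphs of `U i` and `D i`. -/
noncomputable def cycleDrawing (ι : G.MixingInvolution) (m : ℕ) (up : ℕ → α) (e : ℕ → β)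
    (H : ℕ → ℝ) (U D : ℕ → ℝ → ℝ) (idx : Set α → ℕ) (idxE : Set β → ℕ) (s : Spot α β) : Torus :=
  match s with
  | .vert x => stripPoint m (idx (ι.orbitV x)) 0
      (if x = up (idx (ι.orbitV x)) then H (idx (ι.orbitV x)) else -H (idx (ι.orbitV x)))
  | .edge f t => stripPoint m (idxE (ι.orbitE f)) t
      (if f = e (idxE (ι.orbitE f)) then U (idxE (ι.orbitE f)) t else D (idxE (ι.orbitE f)) t)
  -- The disc runs up the meridian from `H` to `1 - H`, which is `-H` modulo 1, and bulges into the
  -- strip on its right.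
  | .lens p t h => stripPoint m (idx p) (h * (t * (1 - t)) / 2)
      (H (idx p) + (1 - 2 * H (idx p)) * t)

section Values

variable {m : ℕ} {up : ℕ → α} {e : ℕ → β} {H : ℕ → ℝ} {U D : ℕ → ℝ → ℝ} {idx : Set α → ℕ}
  {idxE : Set β → ℕ} {i : ℕ}

theorem cycleDrawing_vert_of_eq {x : α} (h : idx (ι.orbitV x) = i) (hx : x = up i) :
    ι.cycleDrawing m up e H U D idx idxE (.vert x) = stripPoint m i 0 (H i) := by
  subst h
  exact congrArg (stripPoint m _ _) (if_pos hx)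

theorem cycleDrawing_vert_of_ne {x : α} (h : idx (ι.orbitV x) = i) (hx : x ≠ up i) :
    ι.cycleDrawing m up e H U D idx idxE (.vert x) = stripPoint m i 0 (-H i) := by
  subst h
  exact congrArg (stripPoint m _ _) (if_neg hx)

theorem cycleDrawing_edge_of_eq {f : β} (h : idxE (ι.orbitE f) = i) (hf : f = e i) (t : ℝ) :
    ι.cycleDrawing m up e H U D idx idxE (.edge f t) = stripPoint m i t (U i t) := by
  subst h
  exact congrArg (stripPoint m _ _) (if_pos hf)

theorem cycleDrawing_edge_of_ne {f : β} (h : idxE (ι.orbitE f) = i) (hf : f ≠ e i) (t : ℝ) :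
    ι.cycleDrawing m up e H U D idx idxE (.edge f t) = stripPoint m i t (D i t) := by
  subst h
  exact congrArg (stripPoint m _ _) (if_neg hf)

end Values

/-- Going up a vertical circle inside a strip, one meets `D`, `U`, possibly the disc, then `D + 1`.
All relevant height differences lie strictly between 0 and 1, so no two points coincide modulo 1.
Within a disc the height determines `t`, and the horizontal position then determines `h`. -/
theorem cycleDrawing_injOn {m : ℕ} {up : ℕ → α} {e : ℕ → β}
    {H : ℕ → ℝ} {U D : ℕ → ℝ → ℝ} {idx : Set α → ℕ} {idxE : Set β → ℕ}
    (hup : ∀ i ≤ m, up i ∈ V(G)) (he : ∀ i ≤ m, e i ∈ E(G))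
    (hidx : ∀ i ≤ m, idx (ι.orbitV (up i)) = i) (hidxE : ∀ i ≤ m, idxE (ι.orbitE (e i)) = i)
    (hH : ∀ i ≤ m, 0 ≤ H i ∧ H i ≤ 1 / 4 ∧ (H i = 0 → ι.onV (up i) = up i))
    (hgap : ∀ i ≤ m, ∀ σ, 0 < σ → σ < 1 → 0 < U i σ - D i σ ∧ U i σ - D i σ < 1)
    (hlens : ∀ i ≤ m, ∀ σ t, 0 < σ → σ ≤ t / 2 → σ ≤ (1 - t) / 2 →
      U i σ < H i + (1 - 2 * H i) * t ∧ H i + (1 - 2 * H i) * t < D i σ + 1) :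
    Set.InjOn (ι.cycleDrawing m up e H U D idx idxE)
      (ι.spots ((fun i => ι.orbitV (up i)) '' Set.Iic m)
        {f | f ∈ E(G) ∧ ι.orbitE f ∈ (fun i => ι.orbitE (e i)) '' Set.Iic m}) := by
  set S := (fun i => ι.orbitV (up i)) '' Set.Iic m
  set A := {f | f ∈ E(G) ∧ ι.orbitE f ∈ (fun i => ι.orbitE (e i)) '' Set.Iic m}
  set Φ := ι.cycleDrawing m up e H U D idx idxE
  have hw : ∀ t h : ℝ, 0 < t → t < 1 → 0 ≤ h → h ≤ 1 → 0 ≤ h * (t * (1 - t)) / 2 ∧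
      h * (t * (1 - t)) / 2 ≤ t / 2 ∧ h * (t * (1 - t)) / 2 ≤ (1 - t) / 2 := by
    intro t h h0 h1 h2 h3
    have h4 : 0 < t * (1 - t) := mul_pos h0 (by linarith)
    have h5 : h * (t * (1 - t)) ≤ t * (1 - t) := mul_le_of_le_one_left h4.le h3
    refine ⟨by positivity, ?_, ?_⟩ <;> nlinarith
  have hV : ∀ x, Spot.vert x ∈ ι.spots S A → ∃ i ≤ m, ι.orbitV x = ι.orbitV (up i) ∧
      ((x = up i ∧ Φ (.vert x) = stripPoint m i 0 (H i)) ∨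
        (x = ι.onV (up i) ∧ ι.onV (up i) ≠ up i ∧ Φ (.vert x) = stripPoint m i 0 (-H i))) := by
    rintro x ⟨-, i, hi, hx⟩
    have hi : i ≤ m := hi
    dsimp only at hx
    refine ⟨i, hi, hx.symm, ?_⟩
    have h1 : idx (ι.orbitV x) = i := by rw [← hx, hidx i hi]
    by_cases h2 : x = up i
    · exact Or.inl ⟨h2, cycleDrawing_vert_of_eq h1 h2⟩
    · have h3 := ((ι.orbitV_eq_orbitV_iff (hup i hi)).1 hx.symm).resolve_left h2
      exact Or.inr ⟨h3, h3 ▸ h2, cycleDrawing_vert_of_ne h1 h2⟩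
  have hE : ∀ f t, Spot.edge f t ∈ ι.spots S A → ∃ i ≤ m,
      ((f = e i ∧ Φ (.edge f t) = stripPoint m i t (U i t)) ∨
        (f = ι.onE (e i) ∧ Φ (.edge f t) = stripPoint m i t (D i t))) := by
    rintro f t ⟨⟨-, i, hi, hx⟩, -⟩
    have hi : i ≤ m := hi
    dsimp only at hx
    refine ⟨i, hi, ?_⟩
    have h1 : idxE (ι.orbitE f) = i := by rw [← hx, hidxE i hi]
    by_cases h2 : f = e i
    · exact Or.inl ⟨h2, cycleDrawing_edge_of_eq h1 h2 t⟩
    · have h3 := ((ι.orbitE_eq_orbitE_iff (he i hi)).1 hx.symm).resolve_left h2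
      exact Or.inr ⟨h3, cycleDrawing_edge_of_ne h1 h2 t⟩
  have hL : ∀ q t h, Spot.lens q t h ∈ ι.spots S A → ∃ i ≤ m, q = ι.orbitV (up i) ∧
      Φ (.lens q t h) = stripPoint m i (h * (t * (1 - t)) / 2) (H i + (1 - 2 * H i) * t) := by
    rintro q t h ⟨⟨i, hi, rfl⟩, -⟩
    refine ⟨i, hi, rfl, ?_⟩
    simp only [Φ, cycleDrawing, hidx i hi]
  have hVE : ∀ x f t, Spot.vert x ∈ ι.spots S A → Spot.edge f t ∈ ι.spots S A →
      Φ (.vert x) ≠ Φ (.edge f t) := by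
    intro x f t hx hf h
    have ht := hf.2
    obtain ⟨i, hi, -, hx⟩ := hV x hx
    obtain ⟨j, hj, hf⟩ := hE f t hf
    rcases hx with ⟨-, hx⟩ | ⟨-, -, hx⟩ <;> rcases hf with ⟨-, hf⟩ | ⟨-, hf⟩ <;>
      rw [hx, hf] at h <;>
      linarith [(stripPoint_eq hi hj le_rfl one_pos ht.1.le ht.2 h).2.1]
  have hVL : ∀ x q t h, Spot.vert x ∈ ι.spots S A → Spot.lens q t h ∈ ι.spots S A →
      Φ (.vert x) ≠ Φ (.lens q t h) := by
    intro x q t h hx hf heq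
    have ht := hf.2
    have hw' := hw t h ht.1 ht.2.1 ht.2.2.1 ht.2.2.2
    obtain ⟨i, hi, -, hx⟩ := hV x hx
    obtain ⟨j, hj, -, hf⟩ := hL q t h hf
    obtain ⟨hH0, hH1, -⟩ := hH i hi
    have h1 : 0 < (1 - 2 * H i) * t := mul_pos (by linarith) ht.1
    have h2 : 0 < (1 - 2 * H i) * (1 - t) := mul_pos (by linarith) (by linarith)
    rcases hx with ⟨-, hx⟩ | ⟨-, -, hx⟩ <;> rw [hx, hf, eq_comm] at heq <;>
      obtain ⟨rfl, -, k, hk⟩ := stripPoint_eq hj hi hw'.1 (by linarith) le_rfl one_pos heq <;>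
      exact ne_intCast_of_pos_of_lt_one (by linarith) (by linarith) k hk
  have hEL : ∀ f s q t h, Spot.edge f s ∈ ι.spots S A → Spot.lens q t h ∈ ι.spots S A →
      Φ (.edge f s) ≠ Φ (.lens q t h) := by
    intro f s q t h hx hf heq
    have hs := hx.2
    have ht := hf.2
    have hw' := hw t h ht.1 ht.2.1 ht.2.2.1 ht.2.2.2
    obtain ⟨i, hi, hx⟩ := hE f s hx
    obtain ⟨j, hj, -, hf⟩ := hL q t h hf
    have h1 := hgap i hi s hs.1 hs.2
    rcases hx with ⟨-, hx⟩ | ⟨-, hx⟩ <;> rw [hx, hf, eq_comm] at heq <;>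
      obtain ⟨rfl, hst, k, hk⟩ := stripPoint_eq hj hi hw'.1 (by linarith) hs.1.le hs.2 heq <;>
      rw [hst] at hw' <;>
      have h2 := hlens j hj s t hs.1 hw'.2.1 hw'.2.2 <;>
      exact ne_intCast_of_pos_of_lt_one (by linarith) (by linarith) k hk
  rintro (x | ⟨f, t⟩ | ⟨q, t, h⟩) hs (x' | ⟨f', t'⟩ | ⟨q', t', h'⟩) hs' heq
  · obtain ⟨i, hi, -, hx⟩ := hV x hs
    obtain ⟨j, hj, -, hx'⟩ := hV x' hs'
    obtain ⟨hH0, hH1, hH2⟩ := hH i hi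
    rcases hx with ⟨hx1, hx⟩ | ⟨hx1, hne, hx⟩ <;> rcases hx' with ⟨hx1', hx'⟩ | ⟨hx1', hne', hx'⟩ <;>
      rw [hx, hx'] at heq <;>
      obtain ⟨rfl, -, k, hk⟩ := stripPoint_eq hi hj le_rfl one_pos le_rfl one_pos heq
    · rw [hx1, hx1']
    · have : 0 < H i := lt_of_le_of_ne hH0 fun h => hne' (hH2 h.symm)
      exact absurd hk (ne_intCast_of_pos_of_lt_one (by linarith) (by linarith) k)
    · have : 0 < H i := lt_of_le_of_ne hH0 fun h => hne (hH2 h.symm)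
      refine absurd (?_ : H i - -H i = ((-k : ℤ) : ℝ))
        (ne_intCast_of_pos_of_lt_one (by linarith) (by linarith) (-k))
      push_cast
      linarith
    · rw [hx1, hx1']
  · exact absurd heq (hVE _ _ _ hs hs')
  · exact absurd heq (hVL _ _ _ _ hs hs')
  · exact absurd heq.symm (hVE _ _ _ hs' hs)
  · obtain ⟨-, h0, h1⟩ := id hs
    obtain ⟨-, h0', h1'⟩ := id hs'
    obtain ⟨i, hi, hx⟩ := hE f t hs
    obtain ⟨j, hj, hx'⟩ := hE f' t' hs'
    have hg := hgap i hi t h0 h1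
    rcases hx with ⟨hx1, hx⟩ | ⟨hx1, hx⟩ <;> rcases hx' with ⟨hx1', hx'⟩ | ⟨hx1', hx'⟩ <;>
      rw [hx, hx'] at heq <;>
      obtain ⟨rfl, rfl, k, hk⟩ := stripPoint_eq hi hj h0.le h1 h0'.le h1' heq
    · rw [hx1, hx1']
    · exact absurd hk (ne_intCast_of_pos_of_lt_one hg.1 hg.2 k)
    · refine absurd (?_ : U i t - D i t = ((-k : ℤ) : ℝ))
        (ne_intCast_of_pos_of_lt_one hg.1 hg.2 (-k))
      push_cast
      linarith
    · rw [hx1, hx1']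
  · exact absurd heq (hEL _ _ _ _ _ hs hs')
  · exact absurd heq.symm (hVL _ _ _ _ hs' hs)
  · exact absurd heq.symm (hEL _ _ _ _ _ hs' hs)
  · obtain ⟨-, h0, h1, h2, h3⟩ := id hs
    obtain ⟨-, h0', h1', h2', h3'⟩ := id hs'
    obtain ⟨i, hi, hq, hx⟩ := hL q t h hs
    obtain ⟨j, hj, hq', hx'⟩ := hL q' t' h' hs'
    obtain ⟨hH0, hH1, -⟩ := hH i hi
    have hw1 := hw t h h0 h1 h2 h3
    have hw2 := hw t' h' h0' h1' h2' h3'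
    rw [hx, hx'] at heq
    obtain ⟨rfl, hσ, k, hk⟩ := stripPoint_eq hi hj hw1.1 (by linarith) hw2.1 (by linarith) heq
    have htt : t = t' := by
      rcases lt_trichotomy t t' with hlt | rfl | hlt
      · have h4 : 0 < (1 - 2 * H i) * (t' - t) := mul_pos (by linarith) (by linarith)
        have h5 : (1 - 2 * H i) * (t' - t) < 1 := by nlinarith
        refine absurd (?_ : (1 - 2 * H i) * (t' - t) = ((-k : ℤ) : ℝ))
          (ne_intCast_of_pos_of_lt_one h4 h5 (-k))
        push_cast
        linarith
      · rfl
      · have h4 : 0 < (1 - 2 * H i) * (t - t') := mul_pos (by linarith) (by linarith)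
        have h5 : (1 - 2 * H i) * (t - t') < 1 := by nlinarith
        exact absurd (by linarith) (ne_intCast_of_pos_of_lt_one h4 h5 k)
    subst htt
    have h4 : 0 < t * (1 - t) := mul_pos h0 (by linarith)
    have : h = h' := mul_right_cancel₀ h4.ne' (by linarith)
    rw [hq, hq', this]

end MixingInvolution
end Graph
-- Drawing the lifted cycle, with or without a half turn
namespace Graph
namespace MixingInvolution

variable {α β : Type*} {G : Graph α β} {ι : G.MixingInvolution}

theorem continuous_stripPoint {Y : Type*} [TopologicalSpace Y] (m i : ℕ) {f g : Y → ℝ}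
    (hf : Continuous f) (hg : Continuous g) : Continuous fun y => stripPoint m i (f y) (g y) :=
  (continuous_quotient_mk'.comp ((continuous_const.add hf).div_const _)).prodMk
    (continuous_quotient_mk'.comp hg)

theorem cycleDrawing_isDrawing {m : ℕ} {up top : ℕ → α} {e : ℕ → β}
    {H : ℕ → ℝ} {U D : ℕ → ℝ → ℝ} {idx : Set α → ℕ} {idxE : Set β → ℕ}
    (hlink : ∀ i ≤ m, G.IsLink (e i) (up i) (top i))
    (hne : ∀ i ≤ m, ι.orbitV (up i) ≠ ι.orbitV (top i))
    (hidx : ∀ i ≤ m, idx (ι.orbitV (up i)) = i) (hidxE : ∀ i ≤ m, idxE (ι.orbitE (e i)) = i)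
    (hH : ∀ i ≤ m, 0 ≤ H i ∧ H i ≤ 1 / 4 ∧ (H i = 0 ↔ ι.onV (up i) = up i))
    (hU : ∀ i, Continuous (U i)) (hD : ∀ i, Continuous (D i))
    (hU0 : ∀ i, U i 0 = H i) (hD0 : ∀ i, D i 0 = -H i)
    (htop : ∀ i ≤ m, ∃ j ≤ m,
      (top i = up j ∧ stripPoint m i 1 (U i 1) = stripPoint m j 0 (H j) ∧
        stripPoint m i 1 (D i 1) = stripPoint m j 0 (-H j)) ∨
      (top i = ι.onV (up j) ∧ stripPoint m i 1 (U i 1) = stripPoint m j 0 (-H j) ∧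
        stripPoint m i 1 (D i 1) = stripPoint m j 0 (H j)))
    (hgap : ∀ i ≤ m, ∀ σ, 0 < σ → σ < 1 → 0 < U i σ - D i σ ∧ U i σ - D i σ < 1)
    (hlens : ∀ i ≤ m, ∀ σ t, 0 < σ → σ ≤ t / 2 → σ ≤ (1 - t) / 2 →
      U i σ < H i + (1 - 2 * H i) * t ∧ H i + (1 - 2 * H i) * t < D i σ + 1) :
    ι.IsDrawing ((fun i => ι.orbitV (up i)) '' Set.Iic m)
      {f | f ∈ E(G) ∧ ι.orbitE f ∈ (fun i => ι.orbitE (e i)) '' Set.Iic m}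
      (ι.cycleDrawing m up e H U D idx idxE) := by
  have hup : ∀ i ≤ m, up i ∈ V(G) := fun i hi => (hlink i hi).left_mem
  have he : ∀ i ≤ m, e i ∈ E(G) := fun i hi => (hlink i hi).edge_mem
  have hvU : ∀ i ≤ m, ι.cycleDrawing m up e H U D idx idxE (.vert (up i)) =
      stripPoint m i 0 (H i) := fun i hi => cycleDrawing_vert_of_eq (hidx i hi) rfl
  have hoD : ∀ i ≤ m, ι.orbitV (ι.onV (up i)) = ι.orbitV (up i) :=
    fun i hi => ι.orbitV_onV (hup i hi)
  have hvD : ∀ i ≤ m, ι.cycleDrawing m up e H U D idx idxE (.vert (ι.onV (up i))) =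
      stripPoint m i 0 (-H i) := by
    intro i hi
    by_cases h : ι.onV (up i) = up i
    · rw [h, hvU i hi, (hH i hi).2.2.2 h, neg_zero]
    · exact cycleDrawing_vert_of_ne (by rw [hoD i hi, hidx i hi]) h
  have hedge : ∀ f ∈ {f | f ∈ E(G) ∧ ι.orbitE f ∈ (fun i => ι.orbitE (e i)) '' Set.Iic m},
      ∃ i ≤ m,
        (f = e i ∧ ∀ t, ι.cycleDrawing m up e H U D idx idxE (.edge f t) =
          stripPoint m i t (U i t)) ∨
        (f = ι.onE (e i) ∧ ∀ t, ι.cycleDrawing m up e H U D idx idxE (.edge f t) =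
          stripPoint m i t (D i t)) := by
    rintro f ⟨-, i, hi, hx⟩
    have hi : i ≤ m := hi
    dsimp only at hx
    refine ⟨i, hi, ?_⟩
    have h1 : idxE (ι.orbitE f) = i := by rw [← hx, hidxE i hi]
    rcases (ι.orbitE_eq_orbitE_iff (he i hi)).1 hx.symm with h2 | h2
    · exact Or.inl ⟨h2, cycleDrawing_edge_of_eq h1 h2⟩
    · refine Or.inr ⟨h2, cycleDrawing_edge_of_ne h1 ?_⟩
      rw [h2]
      exact ι.onE_ne (hlink i hi) (hne i hi)
  refine ⟨cycleDrawing_injOn hup he hidx hidxE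
    (fun i hi => ⟨(hH i hi).1, (hH i hi).2.1, (hH i hi).2.2.1⟩) hgap hlens, ?_, ?_, ?_, ?_⟩
  · intro f hf
    obtain ⟨i, hi, ⟨-, h⟩ | ⟨-, h⟩⟩ := hedge f hf
    · simp only [h]
      exact continuous_stripPoint m i continuous_id (hU i)
    · simp only [h]
      exact continuous_stripPoint m i continuous_id (hD i)
  · rintro q -
    exact continuous_stripPoint m _ (by fun_prop) (by fun_prop)
  · intro f hf
    obtain ⟨i, hi, h⟩ := hedge f hf
    obtain ⟨j, hj, hj'⟩ := htop i hi
    have htt : ι.onV (ι.onV (up j)) = up j := ι.onV_onV _ (hup j hj)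
    rcases h with ⟨rfl, h⟩ | ⟨rfl, h⟩
    · refine ⟨up i, top i, hlink i hi, ⟨i, hi, rfl⟩, ?_, ?_, ?_⟩
      · rcases hj' with ⟨h1, -⟩ | ⟨h1, -⟩
        · exact ⟨j, hj, by rw [h1]⟩
        · exact ⟨j, hj, by rw [h1, hoD j hj]⟩
      · rw [h, hvU i hi, hU0]
      · rcases hj' with ⟨h1, h2, -⟩ | ⟨h1, h2, -⟩
        · rw [h, h1, hvU j hj, h2]
        · rw [h, h1, hvD j hj, h2]
    · refine ⟨_, _, ι.map_isLink _ _ _ (hlink i hi), ⟨i, hi, (hoD i hi).symm⟩, ?_, ?_, ?_⟩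
      · rcases hj' with ⟨h1, -⟩ | ⟨h1, -⟩
        · exact ⟨j, hj, by rw [h1, hoD j hj]⟩
        · exact ⟨j, hj, by rw [h1, htt]⟩
      · rw [h, hvD i hi, hD0]
      · rcases hj' with ⟨h1, -, h2⟩ | ⟨h1, -, h2⟩
        · rw [h, h1, hvD j hj, h2]
        · rw [h, h1, htt, hvU j hj, h2]
  · rintro _ ⟨i, hi, rfl⟩
    have hi : i ≤ m := hi
    refine ⟨up i, hup i hi, rfl, fun h => ?_⟩
    rw [hvU i hi, hvD i hi]
    simp only [cycleDrawing, hidx i hi]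
    refine ⟨by simp, Prod.ext (by simp [stripPoint]) (unitAddCircle_coe_eq_iff.2 ⟨1, ?_⟩)⟩
    push_cast
    ring

theorem stripPoint_one_of_lt (m i : ℕ) (y : ℝ) : stripPoint m i 1 y = stripPoint m (i + 1) 0 y := by
  simp [stripPoint]

theorem stripPoint_one_last (m : ℕ) {y z : ℝ} (h : ∃ k : ℤ, y - z = k) :
    stripPoint m m 1 y = stripPoint m 0 0 z := by
  refine Prod.ext (unitAddCircle_coe_eq_iff.2 ⟨1, ?_⟩) (unitAddCircle_coe_eq_iff.2 h)
  have : (m : ℝ) + 1 ≠ 0 := by positivity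
  simp [this]

/-- The part of `G` over a cycle of the quotient can be drawn on the torus, once the cycle is lifted
to a path from `up 0` to `top m`, where `top m` is `up 0` or, if the two ends of the path are not
fixed, the other vertex of the orbit of `up 0`. -/
theorem exists_drawing_of_lift {m : ℕ} {up top : ℕ → α} {e : ℕ → β}
    (hlink : ∀ i ≤ m, G.IsLink (e i) (up i) (top i))
    (hne : ∀ i ≤ m, ι.orbitV (up i) ≠ ι.orbitV (top i))
    (hV : Set.InjOn (fun i => ι.orbitV (up i)) (Set.Iic m))
    (hE : Set.InjOn (fun i => ι.orbitE (e i)) (Set.Iic m))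
    (htop : ∀ i < m, top i = up (i + 1))
    (hlast : top m = up 0 ∨
      (top m = ι.onV (up 0) ∧ ι.onV (up 0) ≠ up 0 ∧ ι.onV (up m) ≠ up m)) :
    ∃ Φ : Spot α β → Torus, ι.IsDrawing ((fun i => ι.orbitV (up i)) '' Set.Iic m)
      {f | f ∈ E(G) ∧ ι.orbitE f ∈ (fun i => ι.orbitE (e i)) '' Set.Iic m} Φ := by
  classical
  have hidx : ∀ i ≤ m, Function.invFunOn (fun i => ι.orbitV (up i)) (Set.Iic m)
      (ι.orbitV (up i)) = i := fun i hi => hV.leftInvOn_invFunOn (Set.mem_Iic.2 hi)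
  have hidxE : ∀ i ≤ m, Function.invFunOn (fun i => ι.orbitE (e i)) (Set.Iic m)
      (ι.orbitE (e i)) = i := fun i hi => hE.leftInvOn_invFunOn (Set.mem_Iic.2 hi)
  let H : ℕ → ℝ := fun i => if ι.onV (up i) = up i then 0 else 1 / 4
  have hH : ∀ i, 0 ≤ H i ∧ H i ≤ 1 / 4 ∧ (H i = 0 ↔ ι.onV (up i) = up i) := by
    intro i
    by_cases h : ι.onV (up i) = up i <;> simp [H, h]
  let nxt : ℕ → ℕ := fun i => if i = m then 0 else i + 1
  -- The bump `σ * (1 - σ) / 8` keeps `R` and `-R` apart inside the strip when both end orbits are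
  -- single points.
  let R : ℕ → ℝ → ℝ := fun i σ => (1 - σ) * H i + σ * H (nxt i) + σ * (1 - σ) / 8
  have hR : ∀ i, Continuous (R i) := fun i => by fun_prop
  have hR0 : ∀ i, R i 0 = H i := fun i => by simp [R]
  have hR1 : ∀ i, R i 1 = H (nxt i) := fun i => by simp [R]
  have hgap : ∀ i σ, 0 < σ → σ < 1 → 0 < R i σ - -R i σ ∧ R i σ - -R i σ < 1 := by
    intro i σ h0 h1
    obtain ⟨h2, h3, -⟩ := hH i
    obtain ⟨h4, h5, -⟩ := hH (nxt i)
    have h6 : 0 < σ * (1 - σ) := mul_pos h0 (by linarith)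
    have h7 : σ * (1 - σ) < 1 := by nlinarith
    have h8 : 0 ≤ (1 - σ) * H i := mul_nonneg (by linarith) h2
    have h9 : 0 ≤ σ * H (nxt i) := mul_nonneg h0.le h4
    have h10 : (1 - σ) * H i ≤ (1 - σ) * (1 / 4) := mul_le_mul_of_nonneg_left h3 (by linarith)
    have h11 : σ * H (nxt i) ≤ σ * (1 / 4) := mul_le_mul_of_nonneg_left h5 h0.le
    simp only [R]
    constructor <;> linarith
  have hlens : ∀ i σ t, 0 < σ → σ ≤ t / 2 → σ ≤ (1 - t) / 2 →
      R i σ < H i + (1 - 2 * H i) * t ∧ H i + (1 - 2 * H i) * t < -R i σ + 1 := by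
    intro i σ t h0 h1 h1'
    obtain ⟨h2, h3, -⟩ := hH i
    obtain ⟨h4, h5, -⟩ := hH (nxt i)
    have h6 : R i σ ≤ H i + σ * (3 / 8) := by
      have h11 : σ * H (nxt i) ≤ σ * (1 / 4) := mul_le_mul_of_nonneg_left h5 h0.le
      have h12 : 0 ≤ σ * H i := mul_nonneg h0.le h2
      have h13 : 0 ≤ σ * σ := mul_self_nonneg σ
      simp only [R]
      linarith
    have h7 : (1 / 2) * t ≤ (1 - 2 * H i) * t :=
      mul_le_mul_of_nonneg_right (by linarith) (by linarith)
    have h8 : (1 / 2) * (1 - t) ≤ (1 - 2 * H i) * (1 - t) :=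
      mul_le_mul_of_nonneg_right (by linarith) (by linarith)
    constructor <;> linarith
  rcases hlast with hlast | ⟨hlast, h0, hm⟩
  · refine ⟨_, cycleDrawing_isDrawing (H := H) (U := R) (D := fun i σ => -R i σ) hlink hne hidx
      hidxE (fun i _ => hH i) hR (fun i => (hR i).neg) hR0 (fun i => by simp only [hR0]) ?_
      (fun i _ => hgap i) (fun i _ => hlens i)⟩
    intro i hi
    rcases hi.lt_or_eq with hi | rfl
    · refine ⟨i + 1, hi, Or.inl ⟨htop i hi, ?_, ?_⟩⟩ <;>
        simp only [hR1, nxt, if_neg hi.ne, stripPoint_one_of_lt]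
    · refine ⟨0, Nat.zero_le _, Or.inl ⟨hlast, ?_, ?_⟩⟩ <;>
        exact stripPoint_one_last _ ⟨0, by simp [hR1, nxt]⟩
  · have hH0 : H 0 = 1 / 4 := if_neg h0
    have hHm : H m = 1 / 4 := if_neg hm
    -- Half turn in the last strip: `U` rises from `1/4` to `3/4`, which is `-1/4` modulo 1, and `D`
    -- from `-1/4` to `1/4`. Both end orbits must have two points, at `±1/4`.
    let U : ℕ → ℝ → ℝ := fun i σ => if i = m then 1 / 4 + σ / 2 else R i σ
    let D : ℕ → ℝ → ℝ := fun i σ => if i = m then -(1 / 4) + σ / 2 else -R i σ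
    have hU : ∀ i, i ≠ m → U i = R i := fun i hi => funext fun σ => if_neg hi
    have hD : ∀ i, i ≠ m → D i = fun σ => -R i σ := fun i hi => funext fun σ => if_neg hi
    have hUm : U m = fun σ => 1 / 4 + σ / 2 := funext fun σ => if_pos rfl
    have hDm : D m = fun σ => -(1 / 4) + σ / 2 := funext fun σ => if_pos rfl
    refine ⟨_, cycleDrawing_isDrawing (H := H) (U := U) (D := D) hlink hne hidx hidxE
      (fun i _ => hH i) ?_ ?_ ?_ ?_ ?_ ?_ ?_⟩
    · intro i
      by_cases hi : i = m
      · rw [hi, hUm]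
        fun_prop
      · rw [hU i hi]
        exact hR i
    · intro i
      by_cases hi : i = m
      · rw [hi, hDm]
        fun_prop
      · rw [hD i hi]
        exact (hR i).neg
    · intro i
      by_cases hi : i = m
      · simp [hi, hUm, hHm]
      · rw [hU i hi, hR0]
    · intro i
      by_cases hi : i = m
      · simp [hi, hDm, hHm]
      · simp only [hD i hi, hR0]
    · intro i hi
      rcases hi.lt_or_eq with hi | rfl
      · refine ⟨i + 1, hi, Or.inl ⟨htop i hi, ?_, ?_⟩⟩
        · simp only [hU i hi.ne, hR1, nxt, if_neg hi.ne, stripPoint_one_of_lt]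
        · simp only [hD i hi.ne, hR1, nxt, if_neg hi.ne, stripPoint_one_of_lt]
      · refine ⟨0, Nat.zero_le _, Or.inr ⟨hlast, ?_, ?_⟩⟩
        · exact stripPoint_one_last _ ⟨1, by rw [hUm, hH0]; norm_num⟩
        · exact stripPoint_one_last _ ⟨0, by rw [hDm, hH0]; norm_num⟩
    · intro i _ σ hσ0 hσ1
      by_cases hi : i = m
      · rw [hi, hUm, hDm]
        constructor <;> dsimp only <;> linarith
      · rw [hU i hi, hD i hi]
        exact hgap i σ hσ0 hσ1
    · intro i _ σ t hσ0 hσ1 hσ2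
      by_cases hi : i = m
      · rw [hi, hUm, hDm, hHm]
        constructor <;> dsimp only <;> linarith
      · rw [hU i hi, hD i hi]
        exact hlens i σ t hσ0 hσ1 hσ2

/-- The part of `G` over a cycle of the quotient can be drawn on the torus. -/
theorem exists_drawing_of_cycle {m : ℕ} {p : ℕ → Set α} {a : ℕ → Set β}
    (hp : Set.InjOn p (Set.Iic m)) (ha : Set.InjOn a (Set.Iic m))
    (hlink : ∀ i < m, ι.quotient.IsLink (a i) (p i) (p (i + 1)))
    (hlast : ι.quotient.IsLink (a m) (p m) (p 0)) :
    ∃ Φ : Spot α β → Torus, ι.IsDrawing (p '' Set.Iic m)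
      {f | f ∈ E(G) ∧ ι.orbitE f ∈ a '' Set.Iic m} Φ := by
  obtain ⟨x₀, hx₀, hx₀p⟩ := hlast.right_mem
  have : Nonempty β := by
    obtain ⟨e, -⟩ := hlast
    exact ⟨e⟩
  have hstep : ∀ i x, ∃ e y, i < m → x ∈ V(G) → ι.orbitV x = p i →
      G.IsLink e x y ∧ ι.orbitE e = a i ∧ ι.orbitV y = p (i + 1) := by
    intro i x
    by_cases h : i < m ∧ x ∈ V(G) ∧ ι.orbitV x = p i
    · obtain ⟨e, y, hey⟩ := ι.exists_isLink_of_quotient (hlink i h.1) h.2.1 h.2.2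
      exact ⟨e, y, fun _ _ _ => hey⟩
    · exact ⟨Classical.arbitrary β, x, fun h1 h2 h3 => absurd ⟨h1, h2, h3⟩ h⟩
  choose next nextV hnext using hstep
  let up : ℕ → α := fun n => Nat.rec x₀ (fun i x => nextV i x) n
  have hup : ∀ i ≤ m, up i ∈ V(G) ∧ ι.orbitV (up i) = p i := by
    intro i
    induction i with
    | zero => exact fun _ => ⟨hx₀, hx₀p⟩
    | succ i ih =>
      intro hi
      obtain ⟨h1, h2⟩ := ih (by omega)
      obtain ⟨h3, -, h4⟩ := hnext i (up i) (by omega) h1 h2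
      exact ⟨h3.right_mem, h4⟩
  have hm := hup m le_rfl
  obtain ⟨e', y, hl, he', hy, hlast'⟩ : ∃ e y, G.IsLink e (up m) y ∧ ι.orbitE e = a m ∧
      ι.orbitV y = p 0 ∧ (y = up 0 ∨
        (y = ι.onV (up 0) ∧ ι.onV (up 0) ≠ up 0 ∧ ι.onV (up m) ≠ up m)) := by
    obtain ⟨e, y, hl, he, hy⟩ := ι.exists_isLink_of_quotient hlast hm.1 hm.2
    rcases (ι.orbitV_eq_orbitV_iff hx₀).1 (hy.trans hx₀p.symm) with h | h
    · exact ⟨e, y, hl, he, hy, Or.inl h⟩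
    by_cases h0 : ι.onV x₀ = x₀
    · exact ⟨e, y, hl, he, hy, Or.inl (h.trans h0)⟩
    -- If `up m` is fixed, the partner of the last edge also starts there and ends at `up 0`, so the
    -- lift closes up.
    by_cases h1 : ι.onV (up m) = up m
    · have hl' := ι.map_isLink _ _ _ hl
      rw [h1, h, ι.onV_onV _ hx₀] at hl'
      exact ⟨_, x₀, hl', (ι.orbitE_onE hl.edge_mem).trans he, hx₀p, Or.inl rfl⟩
    · exact ⟨e, y, hl, he, hy, Or.inr ⟨h, h0, h1⟩⟩
  classical
  let e : ℕ → β := fun i => if i = m then e' else next i (up i)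
  let top : ℕ → α := fun i => if i = m then y else up (i + 1)
  have hem : e m = e' := if_pos rfl
  have htm : top m = y := if_pos rfl
  have hei : ∀ i < m, e i = next i (up i) := fun i hi => if_neg hi.ne
  have hti : ∀ i < m, top i = up (i + 1) := fun i hi => if_neg hi.ne
  have hall : ∀ i ≤ m, G.IsLink (e i) (up i) (top i) ∧ ι.orbitE (e i) = a i ∧
      ι.orbitV (up i) ≠ ι.orbitV (top i) := by
    intro i hi
    rcases hi.lt_or_eq with hi | rfl
    · obtain ⟨h1, h2⟩ := hup i hi.le
      obtain ⟨h3, h4, h5⟩ := hnext i (up i) hi h1 h2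
      rw [hei i hi, hti i hi]
      refine ⟨h3, h4, ?_⟩
      rw [h2, (hup (i + 1) hi).2]
      exact ι.quotient_isLink_ne (hlink i hi)
    · rw [hem, htm]
      refine ⟨hl, he', ?_⟩
      rw [hm.2, hy]
      exact ι.quotient_isLink_ne hlast
  have hpV : Set.EqOn (fun i => ι.orbitV (up i)) p (Set.Iic m) := fun i hi => (hup i hi).2
  have haE : Set.EqOn (fun i => ι.orbitE (e i)) a (Set.Iic m) := fun i hi => (hall i hi).2.1
  have := exists_drawing_of_lift (fun i hi => (hall i hi).1) (fun i hi => (hall i hi).2.2)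
    (hp.congr hpV.symm) (ha.congr haE.symm) hti (htm.symm ▸ hlast')
  rwa [hpV.image_eq, haE.image_eq] at this

/-! ### Assembling the cycle, the trees and the edges within orbits -/

/-- A finite connected graph with a mixing involution whose quotient has genus one embeds in the
torus. -/
theorem nonempty_embedding_torus (ι : G.MixingInvolution) (hV : V(G).Finite) (hE : E(G).Finite)
    (hconn : G.IsConnected) (hg : ι.quotient.eulerGenus = 1) : Nonempty (G.Embedding Torus) := by
  have hQ := ι.quotient_isConnected hconn
  have hQV : V(ι.quotient).Finite := hV.image _
  obtain ⟨m, p, a, hp, ha, hlink, hlast⟩ :=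
    hQ.exists_cycle hQV (fun _ _ _ => ι.quotient_isLink_ne) hg
  have hlink' : ∀ i ≤ m, ∃ j ≤ m, ι.quotient.IsLink (a i) (p i) (p j) := by
    intro i hi
    rcases hi.lt_or_eq with hi | rfl
    · exact ⟨i + 1, hi, hlink i hi⟩
    · exact ⟨0, Nat.zero_le _, hlast⟩
  obtain ⟨F, hF, ⟨Φ, hΦ⟩, hc⟩ := hQ.exists_spanning hQV
    (fun S F => ∃ Φ : Spot α β → Torus, ι.IsDrawing S {f | f ∈ E(G) ∧ ι.orbitE f ∈ F} Φ)
    (by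
      rintro S F b r s ⟨Φ, hΦ⟩ hr hs hl hb
      obtain ⟨x, hx, rfl⟩ := hl.left_mem
      obtain ⟨e, z, hez, rfl, rfl⟩ := ι.exists_isLink_of_quotient hl hx rfl
      obtain ⟨Ψ, hΨ⟩ := hΦ.insert_leaf hez hr hs (fun h => hb h.2)
        (fun h => hb (ι.orbitE_onE hez.edge_mem ▸ h.2))
      refine ⟨Ψ, ?_⟩
      convert hΨ using 1
      ext f
      simp only [Set.mem_ofPred_eq, Set.mem_insert_iff, Set.mem_union, Set.mem_singleton_iff,
        ι.orbitE_eq_orbitE_iff hez.edge_mem]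
      have h1 := hez.edge_mem
      have h2 := ι.onE_mem hez.edge_mem
      constructor
      · rintro ⟨h, h' | h'⟩
        · exact Or.inr h'
        · exact Or.inl ⟨h, h'⟩
      · rintro (h | rfl | rfl)
        · exact ⟨h.1, Or.inr h.2⟩
        · exact ⟨h1, Or.inl (Or.inl rfl)⟩
        · exact ⟨h2, Or.inl (Or.inr rfl)⟩)
    _ (p '' Set.Iic m) (a '' Set.Iic m) rfl (exists_drawing_of_cycle hp ha hlink hlast)
    ⟨p 0, 0, Nat.zero_le m, rfl⟩
    (by
      rintro _ ⟨i, hi, rfl⟩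
      obtain ⟨j, -, h⟩ := hlink' i hi
      exact h.left_mem)
    (by
      rintro _ ⟨i, hi, rfl⟩
      obtain ⟨j, -, h⟩ := hlink' i hi
      exact h.edge_mem)
    ((Set.finite_Iic m).image a)
    (by
      rintro _ ⟨i, hi, rfl⟩ r s hrs
      obtain ⟨j, hj, h⟩ := hlink' i hi
      rcases hrs.left_eq_or_eq h with rfl | rfl
      · exact ⟨i, hi, rfl⟩
      · exact ⟨j, hj, rfl⟩)
  rw [hp.ncard_image, ha.ncard_image] at hc
  have hQE : E(ι.quotient).Finite := by
    refine (hE.image ι.orbitE).subset ?_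
    rintro _ ⟨_, _, e, x, y, h, rfl, -⟩
    exact ⟨e, h.edge_mem, rfl⟩
  -- The cycle has as many edges as vertices, so `F` has as many edges as `Q` has vertices, which is
  -- the number of edges of `Q`.
  have hFE : F = E(ι.quotient) := by
    refine Set.eq_of_subset_of_ncard_le hF ?_ hQE
    unfold eulerGenus at hg
    omega
  subst hFE
  obtain ⟨Ψ, hΨ⟩ := hΦ.insert_verticals
    (B := E(G) \ {f | f ∈ E(G) ∧ ι.orbitE f ∈ E(ι.quotient)}) hE.sdiff (by
      rintro f ⟨hf, hf'⟩
      obtain ⟨x, y, h⟩ := exists_isLink_of_mem_edgeSet hf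
      refine ⟨x, y, h, ι.orbitV_mem_quotient h.left_mem, ?_⟩
      by_contra hne
      exact hf' ⟨hf, (ι.quotient_isLink h hne).edge_mem⟩)
  rw [Set.union_sdiff_cancel fun f hf => hf.1] at hΨ
  exact hΨ.nonempty_embedding

end MixingInvolution
end Graph

theorem mainTheorem2 {α β : Type*} (G : Graph α β)
    (hV : V(G).Finite) (hE : E(G).Finite) (hconn : G.IsConnected) (hG : G.IsBielliptic) :
    Nonempty (G.Embedding Graph.Torus) ∧ G.orientableGenus ≤ 1 := by
  obtain ⟨ι, hg⟩ := hG
  have h := ι.nonempty_embedding_torus hV hE hconn hg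
  exact ⟨h, iInf₂_le 1 h⟩
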